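/- Let $n\ge 1$ and $0\le k\le n$ be integers, $\mathfrak g=\mathfrak{sl}_n(\mathbb C)$, $G=\mathrm{SL}_n(\mathbb C)$, and $$\mathfrak a=\mathfrak a_0\oplus\mathfrak a_1\oplus\mathfrak a_{-1},\qquad \mathfrak a_0=\mathfrak{sl}_n,\quad \mathfrak a_1=M=\Lambda^k\mathbb C^n,\quad \mathfrak a_{-1}=M^*=\Lambda^{n-k}\mathbb C^n ,$$ with the natural action of $G$ (conjugation on $\mathfrak{sl}_n$, the exterior powers of the standard action on the other summands). A bracket on $\mathfrak a$ is a bilinear map $[\,,]:\mathfrak a\times\mathfrak a\to\mathfrak a$ (no symmetry and no Jacobi identity is required). It is graded if $[\mathfrak a_i,\mathfrak a_j]\subseteq\mathfrak a_{i+j}$ for all $i,j\in\mathbb Z/3$, and equivariant if $[gx,gy]=g[x,y]$ for all $g\in G$ (equivalently, its structure tensor in $\mathfrak a^*\otimes\mathfrak a^*\otimes\mathfrak a$ is $G$-invariant). It agrees with the $\mathfrak g$-action if, for $X\in\mathfrak g$, $[X,Y]=XY-YX$ for $Y\in\mathfrak g$ and $[X,T]=X\cdot T$ for $T\in M$ and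 for $T\in M^*$, where $X\cdot(v_1\wedge\dots\wedge v_p)=\sum_i v_1\wedge\dots\wedge Xv_i\wedge\dots\wedge v_p$. It is non-trivial if each of the nine blocks $\mathfrak a_i\times\mathfrak a_j\to\mathfrak a_{i+j}$ is non-zero. Theorem. 1. There is a non-trivial, graded, equivariant bracket on $\mathfrak a$ that agrees with the $\mathfrak g$-action if and only if $n=3k$ or $n=3(n-k)$; that is, up to exchanging the roles of $M$ and $M^*$, precisely when $n=3k$. Moreover, if $0<k<n$ and neither equality holds, then for every graded equivariant bracket the blocks $M\times M\to M^*$ and $M^*\times M^*\to M$ are zero. 2. Such a bracket is essentially unique: if $[\,,]$ and $[\,,]'$ are two non-trivial, graded, equivariant brackets that agree with the $\mathfrak g$-action, then there are non-zero scalars $c_{ij}\in\mathbb C$ ($i,j\in\mathbb Z/3$) with $[x,y]'=c_{ij}[x,y]$ for all $x\in\mathfrak a_i$, $y\in\mathfrak a_j$. 3. Let $n=3m$ with $m=k$ or $m=n-k$. For every graded equivariant bracket, the restriction $M\times M\to M^*$ is skew-commuting if $m$ is odd and commuting if $m$ is even. In particular, when $n=3k$ it is skew-commuting for $k$ odd and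 commuting for $k$ even. -/

import Mathlib

namespace TensorAlgebraZ3

/-- The standard module `ℂⁿ`. -/
abbrev V (n : ℕ) : Type := Fin n → ℂ

/-- The Lie algebra `𝔰𝔩ₙ` of traceless complex `n × n` matrices. -/
abbrev sl (n : ℕ) : Type := LieAlgebra.SpecialLinear.sl (Fin n) ℂ

/-- The group `SLₙ(ℂ)`. -/
abbrev SL (n : ℕ) : Type := Matrix.SpecialLinearGroup (Fin n) ℂ

/-- The exterior power `Λᵏ ℂⁿ`. -/
abbrev Ext (n k : ℕ) : Type := ⋀[ℂ]^k (V n)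

/-- The adjoint action of `SLₙ` on `𝔰𝔩ₙ`, by conjugation. -/
noncomputable def adRep (n : ℕ) : Representation ℂ (SL n) (sl n) where
  toFun g :=
    { toFun := fun X => ⟨(g : Matrix (Fin n) (Fin n) ℂ) * X.1 * ((g⁻¹ : SL n) : Matrix (Fin n) (Fin n) ℂ), by
        have hX : Matrix.trace X.1 = 0 := X.2
        change Matrix.trace ((g : Matrix (Fin n) (Fin n) ℂ) * X.1 *
          ((g⁻¹ : SL n) : Matrix (Fin n) (Fin n) ℂ)) = 0
        rw [Matrix.trace_mul_comm, ← mul_assoc, ← Matrix.SpecialLinearGroup.coe_mul,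
          inv_mul_cancel, Matrix.SpecialLinearGroup.coe_one, one_mul, hX]⟩
      map_add' := fun X Y => Subtype.ext (by simp [mul_add, add_mul])
      map_smul' := fun c X => Subtype.ext (by simp) }
  map_one' := by
    ext1 X
    exact Subtype.ext (by simp)
  map_mul' g h := by
    ext1 X
    exact Subtype.ext (by
      simp only [mul_inv_rev, Matrix.SpecialLinearGroup.coe_mul, LinearMap.coe_mk, AddHom.coe_mk,
        Module.End.mul_apply, mul_assoc])

/-- The natural action of `SLₙ` on `Λᵏ ℂⁿ`: `g (v₁ ∧ ⋯ ∧ vₖ) = gv₁ ∧ ⋯ ∧ gvₖ`. -/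
noncomputable def extRep (n k : ℕ) : Representation ℂ (SL n) (Ext n k) where
  toFun g := exteriorPower.map k (Matrix.toLin' (g : Matrix (Fin n) (Fin n) ℂ))
  map_one' := by
    rw [Matrix.SpecialLinearGroup.coe_one, Matrix.toLin'_one]
    exact exteriorPower.map_id
  map_mul' g h := by
    rw [Matrix.SpecialLinearGroup.coe_mul, Matrix.toLin'_mul, exteriorPower.map_comp]
    rfl

/-- The alternating map `(v₁, …, vₖ) ↦ ∑ᵢ v₁ ∧ ⋯ ∧ Xvᵢ ∧ ⋯ ∧ vₖ`. -/
noncomputable def extLieAlt (n k : ℕ) (X : sl n) : V n [⋀^Fin k]→ₗ[ℂ] Ext n k :=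
  { ∑ i : Fin k, (exteriorPower.ιMulti ℂ k (M := V n)).toMultilinearMap.compLinearMap
      (fun j => if j = i then Matrix.toLin' X.1 else LinearMap.id) with
    map_eq_zero_of_eq' := by
      intro v a b hab hne
      have key : ∀ i : Fin k,
          (fun j => (if j = i then Matrix.toLin' X.1 else LinearMap.id : V n →ₗ[ℂ] V n) (v j))
            = Function.update v i (Matrix.toLin' X.1 (v i)) := by
        intro i
        funext j
        by_cases h : j = i
        · subst h; simp
        · simp [h]
      simp only [MultilinearMap.toFun_eq_coe, sum_apply,
        MultilinearMap.compLinearMap_apply, key, AlternatingMap.coe_multilinearMap]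
      rw [Finset.sum_eq_add_of_mem a b (Finset.mem_univ _) (Finset.mem_univ _) hne]
      · have hs : Function.update v b (Matrix.toLin' X.1 (v b))
            = Function.update v a (Matrix.toLin' X.1 (v a)) ∘ Equiv.swap a b := by
          funext j
          by_cases ha : j = a
          · subst ha; simp [Function.update_of_ne hne, Function.update_of_ne hne.symm, hab]
          · by_cases hb : j = b
            · subst hb; simp [hab]
            · simp [Equiv.swap_apply_of_ne_of_ne ha hb, Function.update_of_ne ha,
                Function.update_of_ne hb]
        rw [hs, AlternatingMap.map_swap _ _ hne, add_neg_cancel]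
      · rintro c - ⟨hca, hcb⟩
        exact AlternatingMap.map_eq_zero_of_eq _ _
          (by rw [Function.update_of_ne hca.symm, Function.update_of_ne hcb.symm, hab]) hne }

/-- The natural action of `X ∈ 𝔰𝔩ₙ` on `Λᵏ ℂⁿ` (the differential of `extRep`):
`X (v₁ ∧ ⋯ ∧ vₖ) = ∑ᵢ v₁ ∧ ⋯ ∧ Xvᵢ ∧ ⋯ ∧ vₖ`. -/
noncomputable def extLie (n k : ℕ) (X : sl n) : Ext n k →ₗ[ℂ] Ext n k :=
  exteriorPower.alternatingMapLinearEquiv (extLieAlt n k X)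

theorem extLie_ιMulti (n k : ℕ) (X : sl n) (v : Fin k → V n) :
    extLie n k X (exteriorPower.ιMulti ℂ k v) =
      ∑ i : Fin k, exteriorPower.ιMulti ℂ k
        (Function.update v i (X.1.mulVec (v i))) := by
  have key : ∀ i : Fin k,
      (fun j => (if j = i then Matrix.toLin' X.1 else LinearMap.id : V n →ₗ[ℂ] V n) (v j))
        = Function.update v i (X.1.mulVec (v i)) := by
    intro i
    funext j
    by_cases h : j = i
    · subst h; simp
    · simp [h]
  rw [extLie, exteriorPower.alternatingMapLinearEquiv_apply_ιMulti]
  change (∑ i : Fin k, (exteriorPower.ιMulti ℂ k (M := V n)).toMultilinearMap.compLinearMap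
      (fun j => if j = i then Matrix.toLin' X.1 else LinearMap.id)) v = _
  simp only [sum_apply, MultilinearMap.compLinearMap_apply, key,
    AlternatingMap.coe_multilinearMap]

/-- The vector space `𝔞 = 𝔰𝔩ₙ ⊕ Λᵏ ℂⁿ ⊕ Λⁿ⁻ᵏ ℂⁿ`. -/
abbrev Alg (n k : ℕ) : Type := sl n × Ext n k × Ext n (n - k)

/-- The inclusion of the summand `𝔞₀ = 𝔰𝔩ₙ`. -/
noncomputable def inZero (n k : ℕ) : sl n →ₗ[ℂ] Alg n k :=
  LinearMap.inl ℂ _ _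

/-- The inclusion of the summand `𝔞₁ = M = Λᵏ ℂⁿ`. -/
noncomputable def inPlus (n k : ℕ) : Ext n k →ₗ[ℂ] Alg n k :=
  LinearMap.inr ℂ _ _ ∘ₗ LinearMap.inl ℂ _ _

/-- The inclusion of the summand `𝔞₋₁ = M* = Λⁿ⁻ᵏ ℂⁿ`. -/
noncomputable def inMinus (n k : ℕ) : Ext n (n - k) →ₗ[ℂ] Alg n k :=
  LinearMap.inr ℂ _ _ ∘ₗ LinearMap.inr ℂ _ _

/-- The `ℤ/3`-grading of `𝔞`; the index `2` is `-1`. -/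
noncomputable def grade (n k : ℕ) : ZMod 3 → Submodule ℂ (Alg n k)
  | 0 => LinearMap.range (inZero n k)
  | 1 => LinearMap.range (inPlus n k)
  | 2 => LinearMap.range (inMinus n k)

/-- The action of `SLₙ` on `𝔞`. -/
noncomputable def algRep (n k : ℕ) : Representation ℂ (SL n) (Alg n k) :=
  (adRep n).prod ((extRep n k).prod (extRep n (n - k)))

/-- A (not necessarily associative, commutative or skew-commutative) algebra structure on `𝔞`:
a bilinear product, i.e. a structure tensor in `𝔞* ⊗ 𝔞* ⊗ 𝔞`. -/
abbrev Bracket (n k : ℕ) : Type := Alg n k →ₗ[ℂ] Alg n k →ₗ[ℂ] Alg n k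

variable {n k : ℕ}

/-- The product respects the `ℤ/3`-grading: `[𝔞ᵢ, 𝔞ⱼ] ⊆ 𝔞ᵢ₊ⱼ`. -/
def IsGraded (B : Bracket n k) : Prop :=
  ∀ i j : ZMod 3, ∀ x ∈ grade n k i, ∀ y ∈ grade n k j, B x y ∈ grade n k (i + j)

/-- The structure tensor is `SLₙ`-invariant, i.e. the product is equivariant. -/
def IsEquivariant (B : Bracket n k) : Prop :=
  ∀ (g : SL n) (x y : Alg n k), B (algRep n k g x) (algRep n k g y) = algRep n k g (B x y)

/-- The product agrees with the action of `𝔤 = 𝔰𝔩ₙ` on `𝔤`, on `M` and on `M*`. -/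
structure AgreesWithAction (B : Bracket n k) : Prop where
  zero : ∀ X Y : sl n, B (inZero n k X) (inZero n k Y) = inZero n k ⁅X, Y⁆
  plus : ∀ (X : sl n) (T : Ext n k),
    B (inZero n k X) (inPlus n k T) = inPlus n k (extLie n k X T)
  minus : ∀ (X : sl n) (T : Ext n (n - k)),
    B (inZero n k X) (inMinus n k T) = inMinus n k (extLie n (n - k) X T)

/-- The product is non-trivial: each of the nine blocks `𝔞ᵢ × 𝔞ⱼ → 𝔞ᵢ₊ⱼ` is non-zero. -/
def IsNontrivial (B : Bracket n k) : Prop :=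
  ∀ i j : ZMod 3, ∃ x ∈ grade n k i, ∃ y ∈ grade n k j, B x y ≠ 0

/-- A non-trivial `ℤ/3`-graded algebra structure on `𝔞` that agrees with the `𝔤`-action and has
a Jordan decomposition consistent with the `SLₙ`-action (an invariant structure tensor). -/
structure IsNontrivialGJD (B : Bracket n k) : Prop where
  graded : IsGraded B
  equivariant : IsEquivariant B
  agrees : AgreesWithAction B
  nontrivial : IsNontrivial B

/-- Two products are essentially the same if they agree up to a non-zero scalar in each of the
nine blocks `𝔞ᵢ × 𝔞ⱼ → 𝔞ᵢ₊ⱼ`. -/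
def EssentiallyEqual (B B' : Bracket n k) : Prop :=
  ∃ c : ZMod 3 → ZMod 3 → ℂ, ∀ i j : ZMod 3, c i j ≠ 0 ∧
    ∀ x ∈ grade n k i, ∀ y ∈ grade n k j, B' x y = c i j • B x y

end TensorAlgebraZ3

open TensorAlgebraZ3

/-! Everything is reduced to `SLₙ`-invariant trilinear forms. The pairing `vol (x ∧ y)` on
complementary exterior powers and the trace form on `𝔰𝔩ₙ` are invariant and nondegenerate. A product
`Λᵃ × Λᵇ → Λᶜ` therefore amounts to an invariant form on `Λᵃ × Λᵇ × Λⁿ⁻ᶜ`, and products involving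
`𝔰𝔩ₙ` amount to forms on `Λᵃ × Λᵇ × 𝔰𝔩ₙ` with `a + b = n`.

The diagonal torus forces an invariant form to vanish on every triple of standard basis wedges
unless each index of `Fin n` is used the same number `r` of times; then the three degrees add up to
`r * n`. For `M × M → M*` the degrees are `k, k, k`, so `n ∣ 3k`; with `0 < k < n` this means `3k =
n` or `3k = 2n` (`IsGraded.blocks_eq_zero`).

For `r = 1` or `r = 2` the surviving triples form a single orbit, up to scalars, under monomial
matrices, so one value determines the form (`IsInvariantForm.eq_zero_of_apply_eq_zero`). With a root
vector in the third slot the same holds, and a transvection carries the vanishing over to the Cartan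
part (`IsInvariantForm.eq_zero_of_rootVec`). Each block is thus unique up to a scalar.

Existence uses the wedge product, its conjugate under the Hodge star, the Lie algebra action, and
the moment map dual to that action. For the parity, a monomial matrix exchanges the first two
members of a surviving triple and fixes the third up to sign; the total sign is `(-1) ^ m`
(`IsInvariantForm.flip_eq_of_blocks`). -/

namespace TensorAlgebraZ3

/-! ### Wedge product, volume form and the duality of complementary degrees -/

section Wedge

/-- The standard decomposable vector `e_{s 0} ∧ ⋯ ∧ e_{s (k-1)}`. -/
noncomputable def stdWedge {n k : ℕ} (s : Fin k → Fin n) : Ext n k :=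
  exteriorPower.ιMulti ℂ k (fun j => (Pi.single (s j) 1 : V n))

theorem ext_ιMulti {n k : ℕ} {W : Type*} [AddCommGroup W] [Module ℂ W] {f g : Ext n k →ₗ[ℂ] W}
    (h : ∀ v : Fin k → V n,
      f (exteriorPower.ιMulti ℂ k v) = g (exteriorPower.ιMulti ℂ k v)) : f = g :=
  exteriorPower.linearMap_ext (AlternatingMap.ext h)

theorem ext_stdWedge {n k : ℕ} {W : Type*} [AddCommGroup W] [Module ℂ W] {f g : Ext n k →ₗ[ℂ] W}
    (h : ∀ s : Fin k → Fin n, Function.Injective s → f (stdWedge s) = g (stdWedge s)) : f = g := by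
  apply exteriorPower.linearMap_ext
  refine Module.Basis.ext_alternating (Pi.basisFun ℂ (Fin n)) fun s hs => ?_
  simpa [stdWedge] using h s hs

theorem extRep_ιMulti {n k : ℕ} (g : SL n) (v : Fin k → V n) :
    extRep n k g (exteriorPower.ιMulti ℂ k v) =
      exteriorPower.ιMulti ℂ k (fun j => (g : Matrix (Fin n) (Fin n) ℂ).mulVec (v j)) := by
  change exteriorPower.map k _ _ = _
  rw [exteriorPower.map_apply_ιMulti]
  rfl

theorem stdWedge_comp_perm {n k : ℕ} (s : Fin k → Fin n) (τ : Equiv.Perm (Fin k)) :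
    stdWedge (s ∘ τ) = (Equiv.Perm.sign τ : ℤ) • stdWedge s := by
  have := (exteriorPower.ιMulti ℂ k (M := V n)).map_perm (fun j => (Pi.single (s j) 1 : V n)) τ
  exact this

theorem stdWedge_eq_zero {n k : ℕ} {s : Fin k → Fin n} (hs : ¬ Function.Injective s) :
    stdWedge s = 0 := by
  apply AlternatingMap.map_eq_zero_of_not_injective
  contrapose! hs
  intro a b hab
  exact hs (by simp [hab])

theorem exists_stdWedge_eq_smul {n k : ℕ} {s t : Fin k → Fin n} (hs : Function.Injective s)
    (ht : Function.Injective t) (h : Set.range s = Set.range t) :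
    ∃ c : ℂ, c ≠ 0 ∧ stdWedge s = c • stdWedge t := by
  let τ : Equiv.Perm (Fin k) :=
    (Equiv.ofInjective s hs).trans ((Equiv.setCongr h).trans (Equiv.ofInjective t ht).symm)
  have hτ : s = t ∘ τ := by
    funext j
    simp only [τ, Function.comp_apply, Equiv.trans_apply]
    rw [Equiv.apply_ofInjective_symm ht]
    rfl
  refine ⟨((Equiv.Perm.sign τ : ℤ) : ℂ), ?_, ?_⟩
  · exact_mod_cast (Equiv.Perm.sign τ).ne_zero
  · rw [hτ, stdWedge_comp_perm]
    exact (Int.cast_smul_eq_zsmul ℂ _ _).symm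

/-- The wedge product `Λᵃ × Λᵇ → Λᵃ⁺ᵇ`. -/
noncomputable def wedge (n a b : ℕ) : Ext n a →ₗ[ℂ] Ext n b →ₗ[ℂ] Ext n (a + b) :=
  LinearMap.mk₂ ℂ (fun x y => ⟨x.1 * y.1, SetLike.mul_mem_graded x.2 y.2⟩)
    (fun _ _ _ => Subtype.ext (add_mul _ _ _)) (fun _ _ _ => Subtype.ext (smul_mul_assoc _ _ _))
    (fun _ _ _ => Subtype.ext (mul_add _ _ _)) (fun _ _ _ => Subtype.ext (mul_smul_comm _ _ _))

theorem wedge_ιMulti {n a b : ℕ} (v : Fin a → V n) (w : Fin b → V n) :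
    wedge n a b (exteriorPower.ιMulti ℂ a v) (exteriorPower.ιMulti ℂ b w) =
      exteriorPower.ιMulti ℂ (a + b) (Fin.append v w) := by
  apply Subtype.ext
  change ExteriorAlgebra.ιMulti ℂ a v * ExteriorAlgebra.ιMulti ℂ b w =
    ExteriorAlgebra.ιMulti ℂ (a + b) (Fin.append v w)
  simp only [ExteriorAlgebra.ιMulti_apply]
  rw [← List.prod_append, ← List.ofFn_fin_append]
  congr 2
  funext i
  refine Fin.addCases (fun i => ?_) (fun i => ?_) i <;> simp

theorem wedge_stdWedge {n a b : ℕ} (s : Fin a → Fin n) (t : Fin b → Fin n) :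
    wedge n a b (stdWedge s) (stdWedge t) = stdWedge (Fin.append s t) := by
  rw [stdWedge, stdWedge, wedge_ιMulti, stdWedge]
  congr 1
  funext i
  refine Fin.addCases (fun i => ?_) (fun i => ?_) i <;> simp

theorem wedge_extRep {n a b : ℕ} (g : SL n) (x : Ext n a) (y : Ext n b) :
    wedge n a b (extRep n a g x) (extRep n b g y) = extRep n (a + b) g (wedge n a b x y) := by
  have : (wedge n a b).compl₁₂ (extRep n a g) (extRep n b g) =
      (wedge n a b).compr₂ (extRep n (a + b) g) := by
    refine ext_ιMulti fun v => ext_ιMulti fun w => ?_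
    simp only [LinearMap.compl₁₂_apply, LinearMap.compr₂_apply,
      extRep_ιMulti, wedge_ιMulti]
    congr 1
    funext i
    refine Fin.addCases (fun i => ?_) (fun i => ?_) i <;> simp
  exact LinearMap.congr_fun₂ this x y

/-- The volume form `Λᴺ ℂⁿ → ℂ` for `N = n`. -/
noncomputable def vol {n N : ℕ} (h : N = n) : Ext n N →ₗ[ℂ] ℂ :=
  exteriorPower.alternatingMapLinearEquiv
    ((Matrix.detRowAlternating (R := ℂ) (n := Fin n)).domDomCongr (finCongr h.symm))

theorem vol_ιMulti {n N : ℕ} (h : N = n) (v : Fin N → V n) :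
    vol h (exteriorPower.ιMulti ℂ N v) = Matrix.det (Matrix.of fun i => v (finCongr h.symm i)) := by
  rw [vol, exteriorPower.alternatingMapLinearEquiv_apply_ιMulti]
  rfl

theorem vol_extRep {n N : ℕ} (h : N = n) (g : SL n) (x : Ext n N) :
    vol h (extRep n N g x) = vol h x := by
  have : vol h ∘ₗ extRep n N g = vol h := by
    refine ext_ιMulti fun v => ?_
    simp only [LinearMap.comp_apply, extRep_ιMulti, vol_ιMulti]
    have : (Matrix.of fun i => (g : Matrix (Fin n) (Fin n) ℂ).mulVec (v (finCongr h.symm i))) =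
        (Matrix.of fun i => v (finCongr h.symm i)) * (g : Matrix (Fin n) (Fin n) ℂ).transpose := by
      ext i j
      simp [Matrix.mul_apply, Matrix.mulVec, dotProduct, mul_comm]
    rw [this, Matrix.det_mul, Matrix.det_transpose, g.2, mul_one]
  exact LinearMap.congr_fun this x

theorem vol_stdWedge_ne_zero {n N : ℕ} (h : N = n) {s : Fin N → Fin n}
    (hs : Function.Injective s) : vol h (stdWedge s) ≠ 0 := by
  subst h
  have hb := Finite.injective_iff_bijective.1 hs
  rw [stdWedge, vol_ιMulti]
  have : (Matrix.of fun i => (Pi.single (s (finCongr rfl i)) 1 : V N)) =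
      (Equiv.ofBijective s hb).toPEquiv.toMatrix := by
    ext i j
    simp [Pi.single_apply, PEquiv.toMatrix_apply, eq_comm]
  rw [this, Matrix.det_permutation]
  exact_mod_cast (Equiv.Perm.sign _).ne_zero

/-- The pairing `Λᵃ × Λᵇ → ℂ`, `(x, y) ↦ vol (x ∧ y)`, for `a + b = n`. -/
noncomputable def volPairing {n a b : ℕ} (h : a + b = n) : Ext n a →ₗ[ℂ] Ext n b →ₗ[ℂ] ℂ :=
  (wedge n a b).compr₂ (vol h)

theorem volPairing_extRep {n a b : ℕ} (h : a + b = n) (g : SL n) (x : Ext n a) (y : Ext n b) :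
    volPairing h (extRep n a g x) (extRep n b g y) = volPairing h x y := by
  simp [volPairing, wedge_extRep, vol_extRep]

/-- Pairing with the wedge over the complement of `S` isolates the coordinate at `S`: any other `T`
of the same size meets that complement, so its term has a repeated factor. -/
theorem volPairing_injective {n a b : ℕ} (h : a + b = n) :
    Function.Injective (volPairing h) := by
  rw [← LinearMap.ker_eq_bot, LinearMap.ker_eq_bot']
  intro w hw
  let β := (Pi.basisFun ℂ (Fin n)).exteriorPower a
  have hβ : ∀ S, β S = stdWedge (Set.powersetCard.ofFinEmbEquiv.symm S) := by
    intro S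
    simp only [β, exteriorPower.basis_apply, exteriorPower.ιMulti_family, stdWedge]
    congr 1
    funext j
    simp
  apply β.repr.injective
  ext S
  rw [map_zero, Finsupp.zero_apply]
  have hc : (S : Finset (Fin n))ᶜ.card = b := by
    have : (S : Finset (Fin n)).card = a := S.2
    rw [Finset.card_compl, this, Fintype.card_fin]; omega
  let t := (S : Finset (Fin n))ᶜ.orderEmbOfFin hc
  have ht : ∀ i, i ∈ Set.range t ↔ i ∉ (S : Finset (Fin n)) := by
    intro i; simp [t, Set.powersetCard.mem_coe_iff]
  have h1 := LinearMap.congr_fun hw (stdWedge t)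
  rw [← β.sum_repr w] at h1
  simp only [map_sum, LinearMap.sum_apply, map_smul, LinearMap.smul_apply, hβ, volPairing,
    LinearMap.compr₂_apply, wedge_stdWedge, LinearMap.zero_apply, smul_eq_mul] at h1
  rw [Finset.sum_eq_single S] at h1
  · refine (mul_eq_zero.1 h1).resolve_right (vol_stdWedge_ne_zero h ?_)
    rw [Fin.append_injective_iff]
    refine ⟨(Set.powersetCard.ofFinEmbEquiv.symm S).injective, t.injective, ?_⟩
    intro i j hij
    have h2 : t j ∉ (S : Finset (Fin n)) := (ht _).1 ⟨j, rfl⟩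
    apply h2
    rw [← hij]
    exact (Set.powersetCard.mem_range_ofFinEmbEquiv_symm_iff_mem S _).1 ⟨i, rfl⟩
  · intro T _ hT
    rw [stdWedge_eq_zero, map_zero, mul_zero]
    rw [Fin.append_injective_iff]
    rintro ⟨-, -, h3⟩
    obtain ⟨i, hi, hi'⟩ := (Set.powersetCard.exists_mem_notMem_iff_ne T S).1 hT
    obtain ⟨p, rfl⟩ := (Set.powersetCard.mem_range_ofFinEmbEquiv_symm_iff_mem T _).2 hi
    obtain ⟨q, hq⟩ := (ht _).2 hi'
    exact h3 p q hq.symm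
  · simp

end Wedge

/-! ### Monomial matrices in `SLₙ` -/

section Monomial

/-- The element of `SLₙ` with `e_x ↦ ε x • e_{σ x}`. -/
noncomputable def monomial {n : ℕ} (σ : Equiv.Perm (Fin n)) (ε : Fin n → ℂ)
    (h : (Equiv.Perm.sign σ : ℂ) * ∏ x, ε x = 1) : SL n :=
  ⟨σ⁻¹.permMatrix ℂ * Matrix.diagonal ε, by
    rw [Matrix.det_mul, Matrix.det_permutation, Matrix.det_diagonal, Equiv.Perm.sign_inv, h]⟩

theorem monomial_apply {n : ℕ} (σ : Equiv.Perm (Fin n)) (ε : Fin n → ℂ)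
    (h : (Equiv.Perm.sign σ : ℂ) * ∏ x, ε x = 1) (y x : Fin n) :
    (monomial σ ε h : Matrix (Fin n) (Fin n) ℂ) y x = if y = σ x then ε x else 0 := by
  change (σ⁻¹.permMatrix ℂ * Matrix.diagonal ε) y x = _
  rw [Matrix.mul_diagonal, Equiv.Perm.permMatrix, PEquiv.toMatrix_apply]
  by_cases hy : y = σ x
  · subst hy; simp
  · have : σ.symm y ≠ x := by rintro rfl; simp at hy
    simp [hy, this]

theorem monomial_mulVec_single {n : ℕ} (σ : Equiv.Perm (Fin n)) (ε : Fin n → ℂ)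
    (h : (Equiv.Perm.sign σ : ℂ) * ∏ x, ε x = 1) (x : Fin n) :
    (monomial σ ε h : Matrix (Fin n) (Fin n) ℂ).mulVec (Pi.single x 1) =
      ε x • (Pi.single (σ x) 1 : V n) := by
  ext y
  rw [Matrix.mulVec_single_one]
  simp [monomial_apply, Pi.single_apply]

theorem extRep_monomial {n k : ℕ} (σ : Equiv.Perm (Fin n)) (ε : Fin n → ℂ)
    (h : (Equiv.Perm.sign σ : ℂ) * ∏ x, ε x = 1) (s : Fin k → Fin n) :
    extRep n k (monomial σ ε h) (stdWedge s) = (∏ j, ε (s j)) • stdWedge (σ ∘ s) := by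
  rw [stdWedge, extRep_ιMulti]
  simp only [monomial_mulVec_single]
  exact (exteriorPower.ιMulti ℂ k (M := V n)).map_smul_univ (fun j => ε (s j))
    (fun j => (Pi.single (σ (s j)) 1 : V n))

/-- The elementary matrix `E_{ij}` with `i ≠ j`. -/
noncomputable def rootVec {n : ℕ} {i j : Fin n} (h : i ≠ j) : sl n :=
  LieAlgebra.SpecialLinear.single i j h 1

theorem val_rootVec {n : ℕ} {i j : Fin n} (h : i ≠ j) :
    (rootVec h).1 = Matrix.single i j (1 : ℂ) := rfl

theorem val_adRep {n : ℕ} (g : SL n) (X : sl n) : (adRep n g X).1 =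
    (g : Matrix (Fin n) (Fin n) ℂ) * X.1 * ((g⁻¹ : SL n) : Matrix (Fin n) (Fin n) ℂ) := rfl

theorem coe_mul_coe_inv {n : ℕ} (g : SL n) :
    (g : Matrix (Fin n) (Fin n) ℂ) * ((g⁻¹ : SL n) : Matrix (Fin n) (Fin n) ℂ) = 1 := by
  rw [← Matrix.SpecialLinearGroup.coe_mul, mul_inv_cancel, Matrix.SpecialLinearGroup.coe_one]

theorem coe_inv_mul_coe {n : ℕ} (g : SL n) :
    ((g⁻¹ : SL n) : Matrix (Fin n) (Fin n) ℂ) * (g : Matrix (Fin n) (Fin n) ℂ) = 1 := by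
  rw [← Matrix.SpecialLinearGroup.coe_mul, inv_mul_cancel, Matrix.SpecialLinearGroup.coe_one]

/-- Clears the inverse from a conjugation, leaving an identity of matrix products. -/
theorem adRep_eq_of_mul_eq {n : ℕ} {g : SL n} {X Y : sl n}
    (h : (g : Matrix (Fin n) (Fin n) ℂ) * X.1 = Y.1 * g) : adRep n g X = Y := by
  apply Subtype.ext
  rw [val_adRep, h, mul_assoc, coe_mul_coe_inv, mul_one]

theorem adRep_monomial {n : ℕ} (σ : Equiv.Perm (Fin n)) (ε : Fin n → ℂ)
    (h : (Equiv.Perm.sign σ : ℂ) * ∏ x, ε x = 1) (hε : ∀ x, ε x ≠ 0) {i j : Fin n} (hij : i ≠ j) :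
    adRep n (monomial σ ε h) (rootVec hij) =
      (ε i / ε j) • rootVec (σ.injective.ne hij) := by
  apply adRep_eq_of_mul_eq
  ext y x
  change _ = (((ε i / ε j) • Matrix.single (σ i) (σ j) (1 : ℂ)) *
    (monomial σ ε h : Matrix (Fin n) (Fin n) ℂ)) y x
  rw [val_rootVec, Matrix.smul_mul, Matrix.smul_apply]
  by_cases hx : x = j
  · subst hx
    rw [Matrix.mul_single_apply_same, monomial_apply]
    by_cases hy : y = σ i
    · subst hy
      rw [Matrix.single_mul_apply_same, monomial_apply]
      have := hε x
      simp; field_simp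
    · rw [Matrix.single_mul_apply_of_ne _ _ _ _ _ hy]; simp [hy]
  · rw [Matrix.mul_single_apply_of_ne _ _ _ _ _ hx]
    by_cases hy : y = σ i
    · subst hy
      rw [Matrix.single_mul_apply_same, monomial_apply, if_neg (by simp [Ne.symm hx])]
      simp
    · rw [Matrix.single_mul_apply_of_ne _ _ _ _ _ hy]; simp

/-- The determinant of a permutation matrix is corrected by rescaling one basis vector by the sign.
-/
theorem exists_sign_prod_eq_one {n : ℕ} (hn : 0 < n) (σ : Equiv.Perm (Fin n)) :
    ∃ ε : Fin n → ℂ, (∀ x, ε x ≠ 0) ∧ (Equiv.Perm.sign σ : ℂ) * ∏ x, ε x = 1 := by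
  refine ⟨Function.update 1 ⟨0, hn⟩ ((Equiv.Perm.sign σ : ℤ) : ℂ), fun x => ?_, ?_⟩
  · by_cases hx : x = ⟨0, hn⟩
    · subst hx; simp
    · simp [Function.update_of_ne hx]
  · rw [Finset.prod_update_of_mem (Finset.mem_univ _)]
    simp only [Pi.one_apply, Finset.prod_const_one, mul_one]
    rcases Int.units_eq_one_or (Equiv.Perm.sign σ) with h | h <;> simp [h]

end Monomial

/-! ### Torus weights and the permutations that match them -/

section Weight

/-- The multiplicity of `x` in the index family `s`: the weight of `stdWedge s`. -/
def weight {n k : ℕ} (s : Fin k → Fin n) (x : Fin n) : ℤ :=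
  ∑ j, (Pi.single (s j) 1 : Fin n → ℤ) x

theorem sum_weight {n k : ℕ} (s : Fin k → Fin n) : ∑ x, weight s x = k := by
  unfold weight
  rw [Finset.sum_comm]
  simp

theorem weight_eq_ite {n k : ℕ} {s : Fin k → Fin n} (hs : Function.Injective s) (x : Fin n) :
    weight s x = if x ∈ Finset.univ.image s then 1 else 0 := by
  unfold weight
  split_ifs with h
  · obtain ⟨j, -, rfl⟩ := Finset.mem_image.1 h
    rw [Finset.sum_eq_single j]
    · simp
    · intro b _ hb
      exact Pi.single_eq_of_ne (hs.ne hb).symm _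
    · simp
  · apply Finset.sum_eq_zero
    intro j _
    apply Pi.single_eq_of_ne
    rintro rfl
    exact h (Finset.mem_image_of_mem _ (Finset.mem_univ _))

theorem prod_zpow_single {n k : ℕ} (s : Fin k → Fin n) (i i' : Fin n) :
    ∏ j, ((2 : ℂ) ^ ((Pi.single i 1 - Pi.single i' 1 : Fin n → ℤ) (s j))) =
      2 ^ (weight s i - weight s i') := by
  have h2 : (2 : ℂ) ≠ 0 := two_ne_zero
  have : weight s i - weight s i' = ∑ j, (Pi.single i 1 - Pi.single i' 1 : Fin n → ℤ) (s j) := by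
    simp [weight, Finset.sum_sub_distrib, Pi.single_apply, eq_comm]
  rw [this]
  induction (Finset.univ : Finset (Fin k)) using Finset.induction_on with
  | empty => simp
  | insert a t ha ih => rw [Finset.prod_insert ha, Finset.sum_insert ha, ih, zpow_add₀ h2]

/-- The torus element `diag(…, 2, …, 1/2, …)` with `2` at `i` and `1/2` at `i'`. -/
noncomputable def torus {n : ℕ} (i i' : Fin n) : SL n :=
  monomial 1 (fun x => 2 ^ ((Pi.single i 1 - Pi.single i' 1 : Fin n → ℤ) x)) (by
    have := prod_zpow_single (id : Fin n → Fin n) i i'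
    simp only [id] at this
    rw [this, weight_eq_ite Function.injective_id, weight_eq_ite Function.injective_id]
    simp)

theorem extRep_torus {n k : ℕ} (i i' : Fin n) (s : Fin k → Fin n) :
    extRep n k (torus i i') (stdWedge s) = (2 : ℂ) ^ (weight s i - weight s i') • stdWedge s := by
  rw [torus, extRep_monomial, prod_zpow_single]
  rfl

theorem adRep_torus {n : ℕ} (i i' : Fin n) {p q : Fin n} (h : p ≠ q) :
    adRep n (torus i i') (rootVec h) =
      (2 : ℂ) ^ ((Pi.single p 1 - Pi.single q 1 : Fin n → ℤ) i -
        (Pi.single p 1 - Pi.single q 1 : Fin n → ℤ) i') • rootVec h := by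
  have h2 : (2 : ℂ) ≠ 0 := two_ne_zero
  rw [torus, adRep_monomial _ _ _ (fun x => zpow_ne_zero _ h2), ← zpow_sub₀ h2]
  congr 2
  simp only [Pi.sub_apply, Pi.single_apply, eq_comm]
  ring

/-- The hypotheses fix the sizes of all four cells of the Venn diagram of two sets; bijections
between corresponding cells glue to a permutation. -/
theorem exists_perm_of_card_eq {α : Type*} [Fintype α] [DecidableEq α] {S T S' T' : Finset α}
    (hS : S.card = S'.card) (hT : T.card = T'.card) (h : (S ∩ T).card = (S' ∩ T').card) :
    ∃ σ : Equiv.Perm α, ∀ x, (σ x ∈ S' ↔ x ∈ S) ∧ (σ x ∈ T' ↔ x ∈ T) := by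
  have hc : ∀ c : Bool × Bool, Nonempty ({a // (decide (a ∈ S), decide (a ∈ T)) = c} ≃
      {a // (decide (a ∈ S'), decide (a ∈ T')) = c}) := by
    intro c
    rw [← Fintype.card_eq, Fintype.card_subtype, Fintype.card_subtype]
    have e : ∀ A B : Finset α, (A ∩ B).card + (A \ B).card = A.card := fun A B => by
      rw [add_comm, Finset.card_sdiff_add_card_inter]
    have e1 := e S T
    have e2 := e S' T'
    have e3 := e T S
    have e4 := e T' S'
    rw [Finset.inter_comm] at e3 e4
    have e5 := Finset.card_union_add_card_inter S T
    have e6 := Finset.card_union_add_card_inter S' T'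
    have e7 := Finset.card_compl_add_card (S ∪ T)
    have e8 := Finset.card_compl_add_card (S' ∪ T')
    obtain ⟨a, b⟩ := c
    have f : ∀ A B : Finset α,
        (Finset.univ.filter fun x => (decide (x ∈ A), decide (x ∈ B)) = (a, b)) =
          match a, b with
          | true, true => A ∩ B
          | true, false => A \ B
          | false, true => B \ A
          | false, false => (A ∪ B)ᶜ := by
      intro A B
      cases a <;> cases b <;> ext x <;> simp [and_comm]
    rw [f, f]
    cases a <;> cases b <;> simp only <;> omega
  let e := fun c => (hc c).some
  refine ⟨Equiv.ofFiberEquiv (f := fun a => (decide (a ∈ S), decide (a ∈ T)))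
    (g := fun a => (decide (a ∈ S'), decide (a ∈ T'))) e, fun x => ?_⟩
  have := Equiv.ofFiberEquiv_map e x
  simp only [Prod.mk.injEq, decide_eq_decide] at this
  exact this

/-- The sum of products is the size of the intersection of the two ranges, the only invariant of a
pair of subsets of given sizes under permutations. -/
theorem exists_perm_of_weight {n a b : ℕ} {s s' : Fin a → Fin n} {t t' : Fin b → Fin n}
    (hs : Function.Injective s) (hs' : Function.Injective s') (ht : Function.Injective t)
    (ht' : Function.Injective t')
    (h : ∑ x, weight s x * weight t x = ∑ x, weight s' x * weight t' x) :
    ∃ σ : Equiv.Perm (Fin n), ∀ x,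
      weight s' (σ x) = weight s x ∧ weight t' (σ x) = weight t x := by
  have key : ∀ {s : Fin a → Fin n} {t : Fin b → Fin n}, Function.Injective s →
      Function.Injective t → ∑ x, weight s x * weight t x =
      ((Finset.univ.image s ∩ Finset.univ.image t).card : ℤ) := by
    intro s t hs ht
    simp only [weight_eq_ite hs, weight_eq_ite ht, mul_ite, mul_one, mul_zero, ← ite_and]
    rw [Finset.sum_boole]
    congr 2
    ext x
    simp [and_comm]
  have card : ∀ {k : ℕ} {s : Fin k → Fin n}, Function.Injective s →
      (Finset.univ.image s).card = k := fun hs => by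
    rw [Finset.card_image_of_injective _ hs, Finset.card_univ, Fintype.card_fin]
  rw [key hs ht, key hs' ht', Nat.cast_inj] at h
  obtain ⟨σ, hσ⟩ := exists_perm_of_card_eq ((card hs).trans (card hs').symm)
    ((card ht).trans (card ht').symm) h
  refine ⟨σ, fun x => ⟨?_, ?_⟩⟩
  · simp only [weight_eq_ite hs, weight_eq_ite hs', (hσ x).1]
  · simp only [weight_eq_ite ht, weight_eq_ite ht', (hσ x).2]

theorem exists_stdWedge_eq_smul_comp {n k : ℕ} {s s' : Fin k → Fin n}
    (hs : Function.Injective s) (hs' : Function.Injective s') {σ : Equiv.Perm (Fin n)}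
    (h : ∀ x, weight s' (σ x) = weight s x) :
    ∃ c : ℂ, c ≠ 0 ∧ stdWedge s' = c • stdWedge (σ ∘ s) := by
  refine exists_stdWedge_eq_smul hs' (σ.injective.comp hs) ?_
  ext y
  obtain ⟨x, rfl⟩ := σ.surjective y
  have h1 := h x
  rw [weight_eq_ite hs, weight_eq_ite hs'] at h1
  have : σ x ∈ Finset.univ.image s' ↔ x ∈ Finset.univ.image s := by
    by_cases h2 : x ∈ Finset.univ.image s <;> by_cases h3 : σ x ∈ Finset.univ.image s' <;>
      simp_all
  simpa using this

end Weight

/-! ### Invariant trilinear forms and proportionality -/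

section Forms

variable {A B C : Type*} [AddCommGroup A] [Module ℂ A] [AddCommGroup B] [Module ℂ B]
  [AddCommGroup C] [Module ℂ C]

/-- Invariance of a trilinear form on three representations of `SLₙ`. -/
def IsInvariantForm {n : ℕ} (ρ₁ : Representation ℂ (SL n) A) (ρ₂ : Representation ℂ (SL n) B)
    (ρ₃ : Representation ℂ (SL n) C) (f : A →ₗ[ℂ] B →ₗ[ℂ] C →ₗ[ℂ] ℂ) : Prop :=
  ∀ g x y z, f (ρ₁ g x) (ρ₂ g y) (ρ₃ g z) = f x y z

theorem IsInvariantForm.smul_sub_smul {n : ℕ} {ρ₁ : Representation ℂ (SL n) A}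
    {ρ₂ : Representation ℂ (SL n) B} {ρ₃ : Representation ℂ (SL n) C}
    {f f' : A →ₗ[ℂ] B →ₗ[ℂ] C →ₗ[ℂ] ℂ} (hf : IsInvariantForm ρ₁ ρ₂ ρ₃ f)
    (hf' : IsInvariantForm ρ₁ ρ₂ ρ₃ f') (c c' : ℂ) :
    IsInvariantForm ρ₁ ρ₂ ρ₃ (c • f - c' • f') := by
  intro g x y z
  simp [hf g x y z, hf' g x y z]

/-- Any two nonzero elements of a space of forms, each determined by a single value
that may be taken to be any nonzero value, are proportional. -/
theorem exists_smul_eq_of_apply {ι : Type*} {P : (A →ₗ[ℂ] B →ₗ[ℂ] C →ₗ[ℂ] ℂ) → Prop}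
    {u : ι → A × B × C} {f f' : A →ₗ[ℂ] B →ₗ[ℂ] C →ₗ[ℂ] ℂ}
    (hsub : ∀ c c' : ℂ, P (c • f - c' • f')) (hf : f ≠ 0) (hf' : f' ≠ 0)
    (hspan : (∀ i, f (u i).1 (u i).2.1 (u i).2.2 = 0) → f = 0)
    (hval : ∀ h, P h → ∀ i, f (u i).1 (u i).2.1 (u i).2.2 ≠ 0 →
      h (u i).1 (u i).2.1 (u i).2.2 = 0 → h = 0) :
    ∃ c : ℂ, c ≠ 0 ∧ f' = c • f := by
  obtain ⟨i, hi⟩ : ∃ i, f (u i).1 (u i).2.1 (u i).2.2 ≠ 0 := by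
    by_contra! h
    exact hf (hspan h)
  set p := f (u i).1 (u i).2.1 (u i).2.2 with hp
  set p' := f' (u i).1 (u i).2.1 (u i).2.2 with hp'
  -- The combination `p' • f - p • f'` is built to vanish at the chosen point, hence vanishes
  -- identically.
  have h0 := hval _ (hsub p' p) i hi (by simp [← hp, ← hp', mul_comm])
  have h1 : f' = (p' / p) • f := by
    have h2 : p • f' = p' • f := (sub_eq_zero.1 h0).symm
    rw [div_eq_inv_mul, mul_smul, ← h2, smul_smul, inv_mul_cancel₀ hi, one_smul]
  refine ⟨p' / p, ?_, h1⟩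
  intro h
  rw [h, zero_smul] at h1
  exact hf' h1

end Forms

/-! ### Invariant forms on three exterior powers -/

section ExteriorForms

variable {n a b c : ℕ}

theorem form_eq_zero_of_stdWedge {f : Ext n a →ₗ[ℂ] Ext n b →ₗ[ℂ] Ext n c →ₗ[ℂ] ℂ}
    (h : ∀ (s : Fin a → Fin n) (t : Fin b → Fin n) (u : Fin c → Fin n), Function.Injective s →
      Function.Injective t → Function.Injective u →
      f (stdWedge s) (stdWedge t) (stdWedge u) = 0) : f = 0 :=
  ext_stdWedge fun s hs => ext_stdWedge fun t ht => ext_stdWedge fun u hu => h s t u hs ht hu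

/-- Since `2` is not a root of unity, the elements `torus i i'` detect differences of weights as
integers. -/
theorem zpow_two_eq_one {m : ℤ} (h : (2 : ℂ) ^ m = 1) : m = 0 := by
  have h1 := congrArg (‖·‖) h
  simp only [norm_zpow, Complex.norm_ofNat, norm_one] at h1
  exact (zpow_eq_one_iff_right₀ (by norm_num) (by norm_num)).1 h1

/-- Only index triples of total weight zero contribute to an invariant form. -/
theorem IsInvariantForm.weight_eq {f : Ext n a →ₗ[ℂ] Ext n b →ₗ[ℂ] Ext n c →ₗ[ℂ] ℂ}
    (hf : IsInvariantForm (extRep n a) (extRep n b) (extRep n c) f)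
    {s : Fin a → Fin n} {t : Fin b → Fin n} {u : Fin c → Fin n}
    (h : f (stdWedge s) (stdWedge t) (stdWedge u) ≠ 0) (i i' : Fin n) :
    weight s i + weight t i + weight u i = weight s i' + weight t i' + weight u i' := by
  have h1 := hf (torus i i') (stdWedge s) (stdWedge t) (stdWedge u)
  simp only [extRep_torus, map_smul, LinearMap.smul_apply, smul_eq_mul, ← mul_assoc] at h1
  have h2 := mul_right_cancel₀ h (h1.trans (one_mul _).symm)
  rw [← zpow_add₀ two_ne_zero, ← zpow_add₀ two_ne_zero] at h2
  have := zpow_two_eq_one h2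
  linarith

/-- The total weight is the same at every index; summing it over all `n` indices counts every factor
once. -/
theorem IsInvariantForm.card_mul_weight {f : Ext n a →ₗ[ℂ] Ext n b →ₗ[ℂ] Ext n c →ₗ[ℂ] ℂ}
    (hf : IsInvariantForm (extRep n a) (extRep n b) (extRep n c) f)
    {s : Fin a → Fin n} {t : Fin b → Fin n} {u : Fin c → Fin n}
    (h : f (stdWedge s) (stdWedge t) (stdWedge u) ≠ 0) (i : Fin n) :
    n * (weight s i + weight t i + weight u i) = a + b + c := by
  rw [← sum_weight s, ← sum_weight t, ← sum_weight u, ← Finset.sum_add_distrib,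
    ← Finset.sum_add_distrib, Finset.sum_congr rfl fun x _ => hf.weight_eq h x i]
  simp

theorem weight_eq_zero_or_one {k : ℕ} {s : Fin k → Fin n} (hs : Function.Injective s) (x : Fin n) :
    weight s x = 0 ∨ weight s x = 1 := by
  rw [weight_eq_ite hs]
  split_ifs <;> simp

theorem IsInvariantForm.weight_eq_of_card {r : ℕ} (habc : a + b + c = r * n)
    {f : Ext n a →ₗ[ℂ] Ext n b →ₗ[ℂ] Ext n c →ₗ[ℂ] ℂ}
    (hf : IsInvariantForm (extRep n a) (extRep n b) (extRep n c) f)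
    {s : Fin a → Fin n} {t : Fin b → Fin n} {u : Fin c → Fin n}
    (h : f (stdWedge s) (stdWedge t) (stdWedge u) ≠ 0) (i : Fin n) :
    weight s i + weight t i + weight u i = r := by
  have hn : (n : ℤ) ≠ 0 := by exact_mod_cast (i.pos).ne'
  apply mul_left_cancel₀ hn
  rw [hf.card_mul_weight h i, mul_comm]
  exact_mod_cast habc

/-- For `r = 1` the three ranges are disjoint; for `r = 2` each index is missed by exactly one
family, so `s` and `t` meet exactly off the range of `u`. The overlap thus depends on `r`, `n`, `c`
alone, which puts all weight-zero triples in one orbit. -/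
theorem sum_weight_mul_weight {r : ℕ} (hr : r = 1 ∨ r = 2) {s : Fin a → Fin n} {t : Fin b → Fin n}
    {u : Fin c → Fin n} (hs : Function.Injective s) (ht : Function.Injective t)
    (hu : Function.Injective u) (h : ∀ x, weight s x + weight t x + weight u x = r) :
    ∑ x, weight s x * weight t x = (r - 1) * (n - c) := by
  have : ∀ x, weight s x * weight t x = (r - 1) * (1 - weight u x) := by
    intro x
    have := h x
    rcases hr with rfl | rfl <;> rcases weight_eq_zero_or_one hs x with h1 | h1 <;>
      rcases weight_eq_zero_or_one ht x with h2 | h2 <;>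
      rcases weight_eq_zero_or_one hu x with h3 | h3 <;> rw [h1, h2, h3] at this ⊢ <;> omega
  rw [Finset.sum_congr rfl fun x _ => this x, ← Finset.mul_sum, Finset.sum_sub_distrib, sum_weight]
  simp

/-- An invariant form on three exterior powers whose degrees add up to `n` or `2n` is determined
by its value at one triple of weight zero. -/
theorem IsInvariantForm.eq_zero_of_apply_eq_zero (hn : 0 < n) {r : ℕ} (hr : r = 1 ∨ r = 2)
    (habc : a + b + c = r * n)
    {f : Ext n a →ₗ[ℂ] Ext n b →ₗ[ℂ] Ext n c →ₗ[ℂ] ℂ}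
    (hf : IsInvariantForm (extRep n a) (extRep n b) (extRep n c) f)
    {s : Fin a → Fin n} {t : Fin b → Fin n} {u : Fin c → Fin n} (hs : Function.Injective s)
    (ht : Function.Injective t) (hu : Function.Injective u)
    (hw : ∀ x, weight s x + weight t x + weight u x = r)
    (h : f (stdWedge s) (stdWedge t) (stdWedge u) = 0) : f = 0 := by
  refine form_eq_zero_of_stdWedge fun s' t' u' hs' ht' hu' => ?_
  by_contra hne
  have hw' := hf.weight_eq_of_card habc hne
  obtain ⟨σ, hσ⟩ := exists_perm_of_weight hs hs' ht ht'
    ((sum_weight_mul_weight hr hs ht hu hw).trans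
      (sum_weight_mul_weight hr hs' ht' hu' hw').symm)
  obtain ⟨p, -, hp⟩ := exists_stdWedge_eq_smul_comp hs hs' fun x => (hσ x).1
  obtain ⟨q, -, hq⟩ := exists_stdWedge_eq_smul_comp ht ht' fun x => (hσ x).2
  -- The third family needs no separate matching: its weight is `r` minus the other two.
  obtain ⟨v, -, hv⟩ := exists_stdWedge_eq_smul_comp (σ := σ) hu hu' fun x => by
    have h1 := hw x
    have h2 := hw' (σ x)
    rw [(hσ x).1, (hσ x).2] at h2
    linarith
  obtain ⟨ε, hε, h1⟩ := exists_sign_prod_eq_one hn σ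
  have h2 := hf (monomial σ ε h1) (stdWedge s) (stdWedge t) (stdWedge u)
  simp only [extRep_monomial, map_smul, LinearMap.smul_apply, smul_eq_mul, h, mul_eq_zero,
    Finset.prod_eq_zero_iff, hε, and_false, exists_false, false_or] at h2
  rw [hp, hq, hv] at hne
  simp [h2] at hne

theorem IsInvariantForm.exists_smul_eq (hn : 0 < n) {r : ℕ} (hr : r = 1 ∨ r = 2)
    (habc : a + b + c = r * n) {f f' : Ext n a →ₗ[ℂ] Ext n b →ₗ[ℂ] Ext n c →ₗ[ℂ] ℂ}
    (hf : IsInvariantForm (extRep n a) (extRep n b) (extRep n c) f)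
    (hf' : IsInvariantForm (extRep n a) (extRep n b) (extRep n c) f')
    (h0 : f ≠ 0) (h0' : f' ≠ 0) : ∃ c : ℂ, c ≠ 0 ∧ f' = c • f := by
  refine exists_smul_eq_of_apply (P := IsInvariantForm (extRep n a) (extRep n b) (extRep n c))
    (ι := {p : (Fin a → Fin n) × (Fin b → Fin n) × (Fin c → Fin n) // Function.Injective p.1 ∧
      Function.Injective p.2.1 ∧ Function.Injective p.2.2})
    (u := fun p => (stdWedge p.1.1, stdWedge p.1.2.1, stdWedge p.1.2.2))
    (fun d d' => hf.smul_sub_smul hf' d d') h0 h0' ?_ ?_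
  · intro h
    exact form_eq_zero_of_stdWedge fun s t u hs ht hu => h ⟨(s, t, u), hs, ht, hu⟩
  · rintro f₁ hf₁ ⟨⟨s, t, u⟩, hs, ht, hu⟩ hne hz
    exact hf₁.eq_zero_of_apply_eq_zero hn hr habc hs ht hu (hf.weight_eq_of_card habc hne) hz

theorem IsInvariantForm.eq_zero_of_not_dvd (hn : 0 < n) (habc : ¬ n ∣ a + b + c)
    {f : Ext n a →ₗ[ℂ] Ext n b →ₗ[ℂ] Ext n c →ₗ[ℂ] ℂ}
    (hf : IsInvariantForm (extRep n a) (extRep n b) (extRep n c) f) : f = 0 := by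
  refine form_eq_zero_of_stdWedge fun s t u _ _ _ => ?_
  by_contra hne
  apply habc
  have := hf.card_mul_weight hne ⟨0, hn⟩
  have h2 : (n : ℤ) ∣ ((a + b + c : ℕ) : ℤ) := ⟨_, by push_cast; exact this.symm⟩
  exact_mod_cast h2

end ExteriorForms

/-! ### Root vectors, Cartan elements and the trace form -/

section SpecialLinear

variable {n : ℕ}

/-- The element `1 + E_{ij}` of `SLₙ`. -/
noncomputable def transvectionSL {i j : Fin n} (h : i ≠ j) : SL n :=
  ⟨Matrix.transvection i j 1, Matrix.det_transvection_of_ne i j h 1⟩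

/-- Conjugating a root vector by the opposite transvection produces a Cartan element modulo root
vectors, which is how Cartan values become accessible. -/
theorem adRep_transvectionSL {i j : Fin n} (h : i ≠ j) :
    adRep n (transvectionSL h) (rootVec h.symm) =
      rootVec h.symm + LieAlgebra.SpecialLinear.singleSubSingle i j 1 - rootVec h := by
  apply adRep_eq_of_mul_eq
  change (1 + Matrix.single i j (1 : ℂ)) * Matrix.single j i 1 =
    (Matrix.single j i 1 + (Matrix.single i i 1 - Matrix.single j j 1) - Matrix.single i j 1) *
      (1 + Matrix.single i j 1)
  simp only [add_mul, mul_add, sub_mul, one_mul, mul_one, Matrix.single_mul_single_same,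
    Matrix.single_mul_single_of_ne _ _ _ _ h.symm]
  abel

/-- Each diagonal unit is corrected by the one at `p`; the corrections add up to the trace, which is
zero. -/
theorem sl_eq_sum (X : sl n) (p : Fin n) :
    X = ∑ i, ∑ j, if h : i ≠ j then X.1 i j • rootVec h
      else X.1 i j • LieAlgebra.SpecialLinear.singleSubSingle i p 1 := by
  have hX : ∑ i, X.1 i i = 0 := X.2
  have key : ∀ i j, ((if h : i ≠ j then X.1 i j • rootVec h
      else X.1 i j • LieAlgebra.SpecialLinear.singleSubSingle i p 1 : sl n)).1 =
      Matrix.single i j (X.1 i j) - if i = j then Matrix.single p p (X.1 i j) else 0 := by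
    intro i j
    by_cases h : i = j
    · subst h
      rw [dif_neg (by simp), if_pos rfl]
      change X.1 i i • (Matrix.single i i (1 : ℂ) - Matrix.single p p 1) = _
      simp [smul_sub]
    · rw [dif_pos h, if_neg h]
      change X.1 i j • Matrix.single i j (1 : ℂ) = _
      simp
  apply Subtype.ext
  rw [AddSubmonoidClass.coe_finsetSum]
  simp only [AddSubmonoidClass.coe_finsetSum, key, Finset.sum_sub_distrib]
  rw [← Matrix.matrix_eq_sum_single]
  have : ∑ i, Matrix.single p p (X.1 i i) = Matrix.single p p (∑ i, X.1 i i) :=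
    (map_sum (Matrix.singleLinearMap ℂ p p) _ _).symm
  simp [this, hX]

theorem ext_sl {W : Type*} [AddCommGroup W] [Module ℂ W] {f g : sl n →ₗ[ℂ] W}
    (h : ∀ i j (hij : i ≠ j), f (rootVec hij) = g (rootVec hij))
    (h' : ∀ i j, i ≠ j → f (LieAlgebra.SpecialLinear.singleSubSingle i j 1) =
      g (LieAlgebra.SpecialLinear.singleSubSingle i j 1)) : f = g := by
  ext X
  obtain hn | ⟨⟨p⟩⟩ := isEmpty_or_nonempty (Fin n)
  · have : X = 0 := Subtype.ext (Subsingleton.elim _ _)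
    simp [this]
  rw [sl_eq_sum X p]
  simp only [map_sum]
  refine Finset.sum_congr rfl fun i _ => Finset.sum_congr rfl fun j _ => ?_
  split_ifs with hij
  · simp [h]
  · by_cases hp : i = p
    · subst hp
      have : LieAlgebra.SpecialLinear.singleSubSingle i i (1 : ℂ) = 0 := Subtype.ext (by simp)
      simp [this]
    · simp [h' i p hp]

/-- The trace form on `𝔰𝔩ₙ`. -/
noncomputable def tracePairing (n : ℕ) : sl n →ₗ[ℂ] sl n →ₗ[ℂ] ℂ :=
  LinearMap.mk₂ ℂ (fun X Y => Matrix.trace (X.1 * Y.1))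
    (fun _ _ _ => by simp [add_mul]) (fun _ _ _ => by simp)
    (fun _ _ _ => by simp [mul_add]) (fun _ _ _ => by simp)

theorem tracePairing_apply (X Y : sl n) : tracePairing n X Y = Matrix.trace (X.1 * Y.1) := rfl

theorem val_adRep_mul_val_adRep (g : SL n) (X Y : sl n) :
    (adRep n g X).1 * (adRep n g Y).1 = (g : Matrix (Fin n) (Fin n) ℂ) * (X.1 * Y.1) *
      ((g⁻¹ : SL n) : Matrix (Fin n) (Fin n) ℂ) := by
  rw [val_adRep, val_adRep]
  calc _ = (g : Matrix (Fin n) (Fin n) ℂ) * X.1 * (((g⁻¹ : SL n) : Matrix (Fin n) (Fin n) ℂ) * g) *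
        Y.1 * ((g⁻¹ : SL n) : Matrix (Fin n) (Fin n) ℂ) := by simp only [mul_assoc]
    _ = _ := by rw [coe_inv_mul_coe, mul_one]; simp only [mul_assoc]

theorem tracePairing_adRep (g : SL n) (X Y : sl n) :
    tracePairing n (adRep n g X) (adRep n g Y) = tracePairing n X Y := by
  rw [tracePairing_apply, val_adRep_mul_val_adRep, Matrix.trace_mul_comm, ← mul_assoc, coe_inv_mul_coe, one_mul]
  rfl

open scoped ComplexOrder in
theorem tracePairing_injective : Function.Injective (tracePairing n) := by
  rw [← LinearMap.ker_eq_bot, LinearMap.ker_eq_bot']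
  intro X hX
  have ht : Matrix.trace X.1 = 0 := X.2
  -- Testing against the conjugate transpose turns the trace form into the positive definite
  -- Hermitian norm.
  have h1 := LinearMap.congr_fun hX ⟨X.1.conjTranspose, by
    change Matrix.trace X.1.conjTranspose = 0
    rw [Matrix.trace_conjTranspose, ht, star_zero]⟩
  exact Subtype.ext (Matrix.trace_mul_conjTranspose_self_eq_zero_iff.1 h1)

end SpecialLinear

/-! ### Invariant forms on `Λᵃ × Λᵇ × 𝔰𝔩ₙ` -/

section AdjointForms

variable {n a b : ℕ} {f f' : Ext n a →ₗ[ℂ] Ext n b →ₗ[ℂ] sl n →ₗ[ℂ] ℂ}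

/-- An invariant form on `Λᵃ × Λᵇ × 𝔰𝔩ₙ` is determined by its values on root vectors. -/
theorem IsInvariantForm.eq_zero_of_rootVec
    (hf : IsInvariantForm (extRep n a) (extRep n b) (adRep n) f)
    (h : ∀ (s : Fin a → Fin n) (t : Fin b → Fin n), Function.Injective s → Function.Injective t →
      ∀ i j (hij : i ≠ j), f (stdWedge s) (stdWedge t) (rootVec hij) = 0) : f = 0 := by
  have h1 : ∀ i j (hij : i ≠ j) x y, f x y (rootVec hij) = 0 := by
    intro i j hij x y
    have : f.compr₂ (LinearMap.applyₗ (rootVec hij)) = 0 :=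
      ext_stdWedge fun s hs => ext_stdWedge fun t ht => h s t hs ht i j hij
    exact LinearMap.congr_fun₂ this x y
  refine LinearMap.ext fun x => LinearMap.ext fun y => ?_
  refine ext_sl (fun i j hij => h1 i j hij x y) fun i j hij => ?_
  -- Pre-translating `x` and `y` by the inverse leaves them fixed while the root vector is
  -- conjugated. All root-vector values vanish, so only the Cartan term survives.
  have h2 := hf (transvectionSL hij) (extRep n a (transvectionSL hij)⁻¹ x)
    (extRep n b (transvectionSL hij)⁻¹ y) (rootVec hij.symm)
  rw [h1, Representation.self_inv_apply, Representation.self_inv_apply, adRep_transvectionSL,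
    map_sub, map_add, h1, h1, zero_add, sub_zero] at h2
  exact h2

/-- The torus makes the total weight constant. A root has coordinate sum zero, so the total over all
indices is `a + b = n` and the constant is `1`. -/
theorem IsInvariantForm.weight_adjoint_eq (hab : a + b = n)
    (hf : IsInvariantForm (extRep n a) (extRep n b) (adRep n) f)
    {s : Fin a → Fin n} {t : Fin b → Fin n} {p q : Fin n} {hpq : p ≠ q}
    (h : f (stdWedge s) (stdWedge t) (rootVec hpq) ≠ 0) (i : Fin n) :
    weight s i + weight t i + (Pi.single p 1 - Pi.single q 1 : Fin n → ℤ) i = 1 := by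
  have key : ∀ i i', weight s i + weight t i + (Pi.single p 1 - Pi.single q 1 : Fin n → ℤ) i =
      weight s i' + weight t i' + (Pi.single p 1 - Pi.single q 1 : Fin n → ℤ) i' := by
    intro i i'
    have h1 := hf (torus i i') (stdWedge s) (stdWedge t) (rootVec hpq)
    simp only [extRep_torus, adRep_torus, map_smul, LinearMap.smul_apply, smul_eq_mul,
      ← mul_assoc] at h1
    have h2 := mul_right_cancel₀ h (h1.trans (one_mul _).symm)
    rw [← zpow_add₀ two_ne_zero, ← zpow_add₀ two_ne_zero] at h2
    have := zpow_two_eq_one h2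
    linarith
  have hn : (n : ℤ) ≠ 0 := by exact_mod_cast (i.pos).ne'
  apply mul_left_cancel₀ hn
  have h3 : ∑ x, (Pi.single p 1 - Pi.single q 1 : Fin n → ℤ) x = 0 := by simp
  have h4 : ∑ x, (weight s x + weight t x + (Pi.single p 1 - Pi.single q 1 : Fin n → ℤ) x) =
      (n : ℤ) := by
    rw [Finset.sum_add_distrib, Finset.sum_add_distrib, sum_weight, sum_weight, h3, add_zero]
    exact_mod_cast hab
  rw [Finset.sum_congr rfl fun x _ => key x i] at h4
  simpa using h4

/-- The two ranges both miss `p`, both contain `q`, and are complementary elsewhere, so their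
overlap is the single index `q`. -/
theorem sum_weight_mul_weight_adjoint {s : Fin a → Fin n} {t : Fin b → Fin n}
    (hs : Function.Injective s) (ht : Function.Injective t) {p q : Fin n} (hpq : p ≠ q)
    (h : ∀ x, weight s x + weight t x + (Pi.single p 1 - Pi.single q 1 : Fin n → ℤ) x = 1) :
    ∑ x, weight s x * weight t x = 1 := by
  have : ∀ x, weight s x * weight t x = (Pi.single q 1 : Fin n → ℤ) x := by
    intro x
    have := h x
    simp only [Pi.sub_apply, Pi.single_apply] at this ⊢
    by_cases hp : x = p <;> by_cases hq : x = q <;>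
      rcases weight_eq_zero_or_one hs x with h1 | h1 <;>
      rcases weight_eq_zero_or_one ht x with h2 | h2 <;> rw [h1, h2] at this ⊢ <;>
      first | exact absurd (hp.symm.trans hq) hpq | simp_all
  rw [Finset.sum_congr rfl fun x _ => this x]
  simp

theorem IsInvariantForm.eq_zero_of_apply_rootVec_eq_zero (hn : 0 < n) (hab : a + b = n)
    (hf : IsInvariantForm (extRep n a) (extRep n b) (adRep n) f)
    {s : Fin a → Fin n} {t : Fin b → Fin n} (hs : Function.Injective s)
    (ht : Function.Injective t) {p q : Fin n} {hpq : p ≠ q}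
    (hw : ∀ x, weight s x + weight t x + (Pi.single p 1 - Pi.single q 1 : Fin n → ℤ) x = 1)
    (h : f (stdWedge s) (stdWedge t) (rootVec hpq) = 0) : f = 0 := by
  refine hf.eq_zero_of_rootVec fun s' t' hs' ht' p' q' hpq' => ?_
  by_contra hne
  have hw' := hf.weight_adjoint_eq hab hne
  obtain ⟨σ, hσ⟩ := exists_perm_of_weight hs hs' ht ht'
    ((sum_weight_mul_weight_adjoint hs ht hpq hw).trans
      (sum_weight_mul_weight_adjoint hs' ht' hpq' hw').symm)
  obtain ⟨c, -, hc⟩ := exists_stdWedge_eq_smul_comp hs hs' fun x => (hσ x).1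
  obtain ⟨d, -, hd⟩ := exists_stdWedge_eq_smul_comp ht ht' fun x => (hσ x).2
  have hsig : ∀ x, (Pi.single p' 1 - Pi.single q' 1 : Fin n → ℤ) (σ x) =
      (Pi.single p 1 - Pi.single q 1 : Fin n → ℤ) x := by
    intro x
    have h1 := hw x
    have h2 := hw' (σ x)
    rw [(hσ x).1, (hσ x).2] at h2
    linarith
  -- The root is recovered from its weight: `p` is the index with entry `1`, and `q` below the one
  -- with entry `-1`.
  have hp : p' = σ p := by
    have := hsig p
    by_contra hne
    simp only [Pi.sub_apply, Pi.single_apply, if_neg hpq, if_neg (Ne.symm hne)] at this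
    split_ifs at this <;> omega
  have hq : q' = σ q := by
    have := hsig q
    by_contra hne
    simp only [Pi.sub_apply, Pi.single_apply, if_neg hpq.symm, if_neg (Ne.symm hne)] at this
    split_ifs at this <;> omega
  subst hp hq
  obtain ⟨ε, hε, h1⟩ := exists_sign_prod_eq_one hn σ
  have h2 := hf (monomial σ ε h1) (stdWedge s) (stdWedge t) (rootVec hpq)
  simp only [extRep_monomial, adRep_monomial _ _ _ hε, map_smul, LinearMap.smul_apply, smul_eq_mul,
    h, mul_eq_zero, Finset.prod_eq_zero_iff, hε, and_false, exists_false, false_or,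
    div_eq_zero_iff] at h2
  rw [hc, hd] at hne
  simp [h2] at hne

theorem IsInvariantForm.exists_smul_eq_adjoint (hn : 0 < n) (hab : a + b = n)
    (hf : IsInvariantForm (extRep n a) (extRep n b) (adRep n) f)
    (hf' : IsInvariantForm (extRep n a) (extRep n b) (adRep n) f')
    (h0 : f ≠ 0) (h0' : f' ≠ 0) : ∃ c : ℂ, c ≠ 0 ∧ f' = c • f := by
  refine exists_smul_eq_of_apply (P := IsInvariantForm (extRep n a) (extRep n b) (adRep n))
    (ι := {p : (Fin a → Fin n) × (Fin b → Fin n) × (Fin n × Fin n) // Function.Injective p.1 ∧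
      Function.Injective p.2.1 ∧ p.2.2.1 ≠ p.2.2.2})
    (u := fun p => (stdWedge p.1.1, stdWedge p.1.2.1, rootVec p.2.2.2))
    (fun d d' => hf.smul_sub_smul hf' d d') h0 h0' ?_ ?_
  · intro h
    exact hf.eq_zero_of_rootVec fun s t hs ht i j hij => h ⟨(s, t, i, j), hs, ht, hij⟩
  · rintro f₁ hf₁ ⟨⟨s, t, i, j⟩, hs, ht, hij⟩ hne hz
    exact hf₁.eq_zero_of_apply_rootVec_eq_zero hn hab hs ht (hf.weight_adjoint_eq hab hne) hz

end AdjointForms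

/-! ### Equivariance and bilinearity of the Lie algebra action -/

section LieAction

variable {n k : ℕ}

theorem ιMulti_map_update (v : Fin k → V n) (i : Fin k) (w : V n) (g : SL n) :
    exteriorPower.ιMulti ℂ k (Function.update
      (fun j => (g : Matrix (Fin n) (Fin n) ℂ).mulVec (v j)) i
      ((g : Matrix (Fin n) (Fin n) ℂ).mulVec w)) =
    extRep n k g (exteriorPower.ιMulti ℂ k (Function.update v i w)) := by
  rw [extRep_ιMulti]
  congr 1
  funext j
  by_cases h : j = i
  · subst h; simp
  · simp [Function.update_of_ne h]

theorem extLie_adRep (g : SL n) (X : sl n) (T : Ext n k) :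
    extLie n k (adRep n g X) (extRep n k g T) = extRep n k g (extLie n k X T) := by
  have : extLie n k (adRep n g X) ∘ₗ extRep n k g = extRep n k g ∘ₗ extLie n k X := by
    refine ext_ιMulti fun v => ?_
    rw [LinearMap.comp_apply, LinearMap.comp_apply, extRep_ιMulti, extLie_ιMulti, extLie_ιMulti,
      map_sum]
    refine Finset.sum_congr rfl fun i _ => ?_
    rw [← ιMulti_map_update]
    congr 2
    simp only [Matrix.mulVec_mulVec]
    rw [val_adRep, mul_assoc, coe_inv_mul_coe, mul_one]
  exact LinearMap.congr_fun this T

/-- The action `extLie` as a bilinear map. -/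
noncomputable def extLieHom (n k : ℕ) : sl n →ₗ[ℂ] Ext n k →ₗ[ℂ] Ext n k where
  toFun := extLie n k
  map_add' X Y := by
    refine ext_ιMulti fun v => ?_
    simp only [LinearMap.add_apply, extLie_ιMulti, ← Finset.sum_add_distrib]
    refine Finset.sum_congr rfl fun i _ => ?_
    rw [← (exteriorPower.ιMulti ℂ k).map_update_add, ← Matrix.add_mulVec]
    rfl
  map_smul' c X := by
    refine ext_ιMulti fun v => ?_
    simp only [RingHom.id_apply, LinearMap.smul_apply, extLie_ιMulti, Finset.smul_sum]
    refine Finset.sum_congr rfl fun i _ => ?_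
    rw [← (exteriorPower.ιMulti ℂ k).map_update_smul, ← Matrix.smul_mulVec]
    rfl

theorem extLieHom_apply (X : sl n) (T : Ext n k) : extLieHom n k X T = extLie n k X T := rfl

theorem extLie_degree_zero (X : sl n) (T : Ext n 0) : extLie n 0 X T = 0 := by
  have : extLie n 0 X = 0 := by
    refine ext_ιMulti fun v => ?_
    rw [extLie_ιMulti]
    simp
  rw [this, LinearMap.zero_apply]

end LieAction

/-! ### Gram form and Hodge star -/

section Hodge

variable {n k : ℕ}

/-- The Gram form on `Λᵏ ℂⁿ`: `(v₁ ∧ ⋯ ∧ vₖ, w₁ ∧ ⋯ ∧ wₖ) ↦ det (vⱼ ⬝ wᵢ)`. -/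
noncomputable def gram (n k : ℕ) : Ext n k →ₗ[ℂ] Module.Dual ℂ (Ext n k) :=
  exteriorPower.pairingDual ℂ (V n) k ∘ₗ
    exteriorPower.map k (dotProductEquiv ℂ (Fin n)).toLinearMap

theorem gram_ιMulti (v w : Fin k → V n) :
    gram n k (exteriorPower.ιMulti ℂ k v) (exteriorPower.ιMulti ℂ k w) =
      Matrix.det (Matrix.of fun i j => v j ⬝ᵥ w i) := by
  rw [gram, LinearMap.comp_apply, exteriorPower.map_apply_ιMulti,
    exteriorPower.pairingDual_ιMulti_ιMulti]
  rfl

/-- The Gram form is bilinear, not Hermitian, so the adjoint of `g` is its transpose. -/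
theorem gram_extRep (g h : SL n)
    (hgh : (h : Matrix (Fin n) (Fin n) ℂ) = (g : Matrix (Fin n) (Fin n) ℂ).transpose)
    (x y : Ext n k) :
    gram n k (extRep n k g x) y = gram n k x (extRep n k h y) := by
  have : (gram n k).comp (extRep n k g) = (gram n k).compl₂ (extRep n k h) := by
    refine ext_ιMulti fun v => ext_ιMulti fun w => ?_
    rw [LinearMap.comp_apply, LinearMap.compl₂_apply, extRep_ιMulti, extRep_ιMulti, gram_ιMulti,
      gram_ιMulti]
    congr 1
    ext i j
    rw [Matrix.of_apply, Matrix.of_apply, hgh, Matrix.mulVec_transpose, dotProduct_comm,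
      Matrix.dotProduct_mulVec, dotProduct_comm]
  exact LinearMap.congr_fun₂ this x y

theorem gram_stdWedge_self {s : Fin k → Fin n} (hs : Function.Injective s) :
    gram n k (stdWedge s) (stdWedge s) = 1 := by
  rw [stdWedge, gram_ιMulti]
  have : (Matrix.of fun i j => (Pi.single (s j) 1 : V n) ⬝ᵥ (Pi.single (s i) 1 : V n)) = 1 := by
    ext i j
    simp [Matrix.one_apply, Pi.single_apply, hs.eq_iff]
  rw [this, Matrix.det_one]

theorem stdWedge_ne_zero {s : Fin k → Fin n} (hs : Function.Injective s) :
    stdWedge s ≠ 0 := by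
  intro h
  have := gram_stdWedge_self hs
  simp [h] at this

/-- The standard wedges are orthonormal, so the Gram form is the map sending a basis to its dual
basis. -/
theorem gram_injective : Function.Injective (gram n k) := by
  let β := (Pi.basisFun ℂ (Fin n)).exteriorPower k
  have : gram n k = β.toDual := by
    refine β.ext fun S => ?_
    have h1 : gram n k (β S) = exteriorPower.ιMultiDual ℂ k (Pi.basisFun ℂ (Fin n)) S := by
      rw [gram, LinearMap.comp_apply, exteriorPower.basis_apply, exteriorPower.map_apply_ιMulti_family,
        exteriorPower.ιMultiDual]
      congr 2
      funext i
      ext j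
      simp [Pi.single_apply, eq_comm]
    rw [h1, ← exteriorPower.basis_coord, Module.Basis.coe_toDual_self]
  rw [this]
  exact β.toDual_injective

theorem finrank_ext (n k : ℕ) : Module.finrank ℂ (Ext n k) = n.choose k := by
  rw [exteriorPower.finrank_eq, Module.finrank_fin_fun]

/-- The Hodge star `Λᵃ → Λᵇ`, `a + b = n`, given by `gram (⋆x) y = vol (x ∧ y)`. -/
noncomputable def hodgeStar {a b : ℕ} (h : a + b = n) : Ext n a →ₗ[ℂ] Ext n b :=
  (LinearEquiv.ofInjectiveOfFinrankEq (gram n b) gram_injective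
    (Subspace.dual_finrank_eq).symm).symm.toLinearMap ∘ₗ volPairing h

theorem gram_hodgeStar {a b : ℕ} (h : a + b = n) (x : Ext n a) (y : Ext n b) :
    gram n b (hodgeStar h x) y = volPairing h x y := by
  have := (LinearEquiv.ofInjectiveOfFinrankEq (gram n b) gram_injective
    (Subspace.dual_finrank_eq).symm).apply_symm_apply (volPairing h x)
  exact LinearMap.congr_fun this y

theorem hodgeStar_injective {a b : ℕ} (h : a + b = n) : Function.Injective (hodgeStar h) := by
  intro x y hxy
  apply volPairing_injective h
  ext1
  ext z
  simp only [LinearMap.compAlternatingMap_apply]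
  rw [← gram_hodgeStar, ← gram_hodgeStar, hxy]

theorem hodgeStar_surjective {a b : ℕ} (h : a + b = n) : Function.Surjective (hodgeStar h) := by
  refine (LinearMap.injective_iff_surjective_of_finrank_eq_finrank ?_).1 (hodgeStar_injective h)
  rw [finrank_ext, finrank_ext, ← h, Nat.choose_symm_add]

/-- The Hodge star intertwines the action of `g` with that of its inverse transpose. -/
theorem hodgeStar_extRep {a b : ℕ} (h : a + b = n) (g : SL n) (x : Ext n a) :
    hodgeStar h (extRep n a g x) = extRep n b (g⁻¹).transpose (hodgeStar h x) := by
  apply gram_injective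
  ext1
  ext z
  simp only [LinearMap.compAlternatingMap_apply]
  rw [gram_hodgeStar, gram_extRep (g⁻¹).transpose g⁻¹ (by simp), gram_hodgeStar,
    ← volPairing_extRep h g x, Representation.self_inv_apply]

end Hodge

/-! ### Equivariant products versus invariant forms -/

section Products

variable {n : ℕ} {A B C D : Type*} [AddCommGroup A] [Module ℂ A] [AddCommGroup B] [Module ℂ B]
  [AddCommGroup C] [Module ℂ C] [AddCommGroup D] [Module ℂ D]

/-- Equivariance of a bilinear map between representations of `SLₙ`. -/
def IsEquivariantProduct (ρ₁ : Representation ℂ (SL n) A) (ρ₂ : Representation ℂ (SL n) B)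
    (ρ₃ : Representation ℂ (SL n) C) (b : A →ₗ[ℂ] B →ₗ[ℂ] C) : Prop :=
  ∀ g x y, b (ρ₁ g x) (ρ₂ g y) = ρ₃ g (b x y)

variable {ρ₁ : Representation ℂ (SL n) A} {ρ₂ : Representation ℂ (SL n) B}
  {ρ₃ : Representation ℂ (SL n) C} {ρ₄ : Representation ℂ (SL n) D}

theorem IsEquivariantProduct.flip {b : A →ₗ[ℂ] B →ₗ[ℂ] C} (h : IsEquivariantProduct ρ₁ ρ₂ ρ₃ b) :
    IsEquivariantProduct ρ₂ ρ₁ ρ₃ b.flip := fun g x y => h g y x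

theorem IsEquivariantProduct.isInvariantForm {b : A →ₗ[ℂ] B →ₗ[ℂ] C}
    (h : IsEquivariantProduct ρ₁ ρ₂ ρ₃ b) {p : C →ₗ[ℂ] D →ₗ[ℂ] ℂ}
    (hp : ∀ g x y, p (ρ₃ g x) (ρ₄ g y) = p x y) :
    IsInvariantForm ρ₁ ρ₂ ρ₄ (b.compr₂ p) := by
  intro g x y z
  rw [LinearMap.compr₂_apply, LinearMap.compr₂_apply, h, hp]

theorem compr₂_eq_zero_iff {b : A →ₗ[ℂ] B →ₗ[ℂ] C} {p : C →ₗ[ℂ] D →ₗ[ℂ] ℂ}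
    (hp : Function.Injective p) : b.compr₂ p = 0 ↔ b = 0 := by
  constructor
  · intro h
    refine LinearMap.ext fun x => LinearMap.ext fun y => hp ?_
    simpa using LinearMap.congr_fun₂ h x y
  · rintro rfl
    refine LinearMap.ext fun x => LinearMap.ext fun y => ?_
    simp

theorem eq_smul_of_compr₂_eq_smul {b b' : A →ₗ[ℂ] B →ₗ[ℂ] C} {p : C →ₗ[ℂ] D →ₗ[ℂ] ℂ}
    (hp : Function.Injective p) {c : ℂ} (h : b'.compr₂ p = c • b.compr₂ p) : b' = c • b := by
  refine LinearMap.ext fun x => LinearMap.ext fun y => hp ?_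
  have := LinearMap.congr_fun₂ h x y
  simpa using this

/-- An invariant form gives an equivariant product by means of a perfect invariant pairing. -/
theorem IsInvariantForm.exists_product [FiniteDimensional ℂ C] [FiniteDimensional ℂ D]
    {f : A →ₗ[ℂ] B →ₗ[ℂ] D →ₗ[ℂ] ℂ}
    (hf : IsInvariantForm ρ₁ ρ₂ ρ₄ f) {p : C →ₗ[ℂ] D →ₗ[ℂ] ℂ} (hinj : Function.Injective p)
    (hdim : Module.finrank ℂ C = Module.finrank ℂ D)
    (hp : ∀ g x y, p (ρ₃ g x) (ρ₄ g y) = p x y) :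
    ∃ b : A →ₗ[ℂ] B →ₗ[ℂ] C, IsEquivariantProduct ρ₁ ρ₂ ρ₃ b ∧ b.compr₂ p = f := by
  let e : C ≃ₗ[ℂ] Module.Dual ℂ D := LinearEquiv.ofInjectiveOfFinrankEq p hinj
    (hdim.trans (Subspace.dual_finrank_eq).symm)
  have he : ∀ φ, p (e.symm φ) = φ := e.apply_symm_apply
  refine ⟨f.compr₂ e.symm.toLinearMap, fun g x y => hinj ?_, ?_⟩
  · refine LinearMap.ext fun z => ?_
    rw [LinearMap.compr₂_apply, LinearMap.compr₂_apply, LinearEquiv.coe_coe, he,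
      ← ρ₄.self_inv_apply g z, hp, hf, he]
  · exact LinearMap.ext fun x => LinearMap.ext fun y => he _

end Products

/-! ### Uniqueness of equivariant products up to scalars -/

section Uniqueness

variable {n a b c c' : ℕ}

/-- Uniqueness up to scalars of equivariant products `Λᵃ × Λᵇ → Λᶜ`. -/
theorem IsEquivariantProduct.exists_smul_eq_ext (hn : 0 < n) {r : ℕ} (hr : r = 1 ∨ r = 2)
    (hc : c + c' = n) (habc : a + b + c' = r * n) {φ ψ : Ext n a →ₗ[ℂ] Ext n b →ₗ[ℂ] Ext n c}
    (hφ : IsEquivariantProduct (extRep n a) (extRep n b) (extRep n c) φ)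
    (hψ : IsEquivariantProduct (extRep n a) (extRep n b) (extRep n c) ψ)
    (hφ0 : φ ≠ 0) (hψ0 : ψ ≠ 0) : ∃ c : ℂ, c ≠ 0 ∧ ψ = c • φ := by
  have hinj := volPairing_injective hc
  obtain ⟨d, hd, h⟩ := (hφ.isInvariantForm (volPairing_extRep hc)).exists_smul_eq hn hr habc
    (hψ.isInvariantForm (volPairing_extRep hc)) (mt (compr₂_eq_zero_iff hinj).1 hφ0)
    (mt (compr₂_eq_zero_iff hinj).1 hψ0)
  exact ⟨d, hd, eq_smul_of_compr₂_eq_smul hinj h⟩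

/-- Equivariant products `Λᵃ × Λᵇ → Λᶜ` vanish unless `n` divides `a + b - c`. -/
theorem IsEquivariantProduct.eq_zero_ext (hn : 0 < n) (hc : c + c' = n) (habc : ¬ n ∣ a + b + c')
    {φ : Ext n a →ₗ[ℂ] Ext n b →ₗ[ℂ] Ext n c}
    (hφ : IsEquivariantProduct (extRep n a) (extRep n b) (extRep n c) φ) : φ = 0 :=
  (compr₂_eq_zero_iff (volPairing_injective hc)).1
    ((hφ.isInvariantForm (volPairing_extRep hc)).eq_zero_of_not_dvd hn habc)

/-- Uniqueness up to scalars of equivariant products `Λᵃ × Λᵇ → 𝔰𝔩ₙ`, `a + b = n`. -/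
theorem IsEquivariantProduct.exists_smul_eq_sl (hn : 0 < n) (hab : a + b = n)
    {φ ψ : Ext n a →ₗ[ℂ] Ext n b →ₗ[ℂ] sl n}
    (hφ : IsEquivariantProduct (extRep n a) (extRep n b) (adRep n) φ)
    (hψ : IsEquivariantProduct (extRep n a) (extRep n b) (adRep n) ψ)
    (hφ0 : φ ≠ 0) (hψ0 : ψ ≠ 0) : ∃ c : ℂ, c ≠ 0 ∧ ψ = c • φ := by
  obtain ⟨d, hd, h⟩ := (hφ.isInvariantForm tracePairing_adRep).exists_smul_eq_adjoint hn hab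
    (hψ.isInvariantForm tracePairing_adRep)
    (mt (compr₂_eq_zero_iff tracePairing_injective).1 hφ0)
    (mt (compr₂_eq_zero_iff tracePairing_injective).1 hψ0)
  exact ⟨d, hd, eq_smul_of_compr₂_eq_smul tracePairing_injective h⟩

/-- The form `(x, y, X) ↦ vol (φ (x, X) ∧ y)` attached to a product `φ : Λᵃ × 𝔰𝔩ₙ → Λᵃ`. -/
noncomputable def actionForm (hab : a + b = n) (φ : Ext n a →ₗ[ℂ] sl n →ₗ[ℂ] Ext n a) :
    Ext n a →ₗ[ℂ] Ext n b →ₗ[ℂ] sl n →ₗ[ℂ] ℂ :=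
  LinearMap.mk₂ ℂ (fun x y => (volPairing hab).flip y ∘ₗ φ x)
    (fun _ _ _ => by ext; simp) (fun _ _ _ => by ext; simp)
    (fun _ _ _ => by ext; simp) (fun _ _ _ => by ext; simp)

theorem actionForm_apply (hab : a + b = n) (φ : Ext n a →ₗ[ℂ] sl n →ₗ[ℂ] Ext n a) (x : Ext n a)
    (y : Ext n b) (X : sl n) : actionForm hab φ x y X = volPairing hab (φ x X) y := rfl

theorem IsEquivariantProduct.actionForm {hab : a + b = n}
    {φ : Ext n a →ₗ[ℂ] sl n →ₗ[ℂ] Ext n a}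
    (hφ : IsEquivariantProduct (extRep n a) (adRep n) (extRep n a) φ) :
    IsInvariantForm (extRep n a) (extRep n b) (adRep n) (actionForm hab φ) := by
  intro g x y X
  rw [actionForm_apply, actionForm_apply, hφ, volPairing_extRep]

theorem eq_smul_of_actionForm_eq_smul (hab : a + b = n) {φ ψ : Ext n a →ₗ[ℂ] sl n →ₗ[ℂ] Ext n a}
    {c : ℂ} (h : actionForm hab ψ = c • actionForm hab φ) : ψ = c • φ := by
  refine LinearMap.ext fun x => LinearMap.ext fun X => volPairing_injective hab ?_
  refine LinearMap.ext fun y => ?_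
  have := LinearMap.congr_fun (LinearMap.congr_fun₂ h x y) X
  simpa [actionForm_apply] using this

theorem actionForm_ne_zero (hab : a + b = n) {φ : Ext n a →ₗ[ℂ] sl n →ₗ[ℂ] Ext n a} (h : φ ≠ 0) :
    actionForm hab φ ≠ 0 := by
  intro h0
  apply h
  simpa using eq_smul_of_actionForm_eq_smul (c := 0) (φ := φ) (ψ := φ) hab (by rw [h0, smul_zero])

/-- Uniqueness up to scalars of equivariant products `Λᵃ × 𝔰𝔩ₙ → Λᵃ`. -/
theorem IsEquivariantProduct.exists_smul_eq_action (hn : 0 < n) (ha : a ≤ n)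
    {φ ψ : Ext n a →ₗ[ℂ] sl n →ₗ[ℂ] Ext n a}
    (hφ : IsEquivariantProduct (extRep n a) (adRep n) (extRep n a) φ)
    (hψ : IsEquivariantProduct (extRep n a) (adRep n) (extRep n a) ψ)
    (hφ0 : φ ≠ 0) (hψ0 : ψ ≠ 0) : ∃ c : ℂ, c ≠ 0 ∧ ψ = c • φ := by
  have hab := Nat.add_sub_of_le ha
  obtain ⟨d, hd, h⟩ := (hφ.actionForm (hab := hab)).exists_smul_eq_adjoint hn hab
    (hψ.actionForm (hab := hab)) (actionForm_ne_zero hab hφ0) (actionForm_ne_zero hab hψ0)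
  exact ⟨d, hd, eq_smul_of_actionForm_eq_smul hab h⟩

end Uniqueness

/-! ### Construction of nonzero equivariant products -/

section Existence

variable {n a b m l : ℕ}

theorem extLieHom_isEquivariantProduct :
    IsEquivariantProduct (adRep n) (extRep n a) (extRep n a) (extLieHom n a) :=
  extLie_adRep

/-- A root vector replaces the first factor of `e₀ ∧ ⋯ ∧ eₐ₋₁` by `eₐ`, giving another nonzero
wedge; the bounds provide a factor to replace and an unused index. -/
theorem extLieHom_ne_zero (ha : 0 < a) (han : a < n) : extLieHom n a ≠ 0 := by
  intro h
  let s : Fin a → Fin n := Fin.castLE han.le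
  let j : Fin a := ⟨0, ha⟩
  let i : Fin n := ⟨a, han⟩
  have hs : Function.Injective s := Fin.castLE_injective _
  have hi : ∀ p, i ≠ s p := fun p hp => by
    have := congrArg Fin.val hp
    have := p.2
    simp only [i, s, Fin.val_castLE] at *
    omega
  have h1 : extLie n a (rootVec (hi j)) (stdWedge s) = 0 :=
    LinearMap.congr_fun₂ h (rootVec (hi j)) (stdWedge s)
  have h2 : extLie n a (rootVec (hi j)) (stdWedge s) = stdWedge (Function.update s j i) := by
    rw [stdWedge, extLie_ιMulti, Finset.sum_eq_single j]
    · rw [stdWedge]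
      congr 1
      funext p
      by_cases hp : p = j
      · subst hp
        rw [Function.update_self, Function.update_self, val_rootVec, Matrix.mulVec_single_one]
        ext q
        simp [Matrix.single_apply, Pi.single_apply, eq_comm]
      · simp [Function.update_of_ne hp]
    · intro p _ hp
      have : (rootVec (hi j)).1.mulVec (Pi.single (s p) 1 : V n) = 0 := by
        rw [val_rootVec, Matrix.mulVec_single_one]
        ext q
        simp [hs.eq_iff, hp.symm]
      rw [this]
      exact AlternatingMap.map_update_zero _ _ _
    · simp
  rw [h2] at h1
  refine stdWedge_ne_zero ?_ h1
  intro p q hpq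
  by_cases hp : p = j <;> by_cases hq : q = j
  · rw [hp, hq]
  · subst hp
    rw [Function.update_self, Function.update_of_ne hq] at hpq
    exact absurd hpq (hi q)
  · subst hq
    rw [Function.update_self, Function.update_of_ne hp] at hpq
    exact absurd hpq.symm (hi p)
  · rw [Function.update_of_ne hp, Function.update_of_ne hq] at hpq
    exact hs hpq

/-- The moment map `Λᵃ × Λᵇ → 𝔰𝔩ₙ`, `a + b = n`. -/
theorem exists_product_sl (ha : 0 < a) (hb : 0 < b) (hab : a + b = n) :
    ∃ φ : Ext n a →ₗ[ℂ] Ext n b →ₗ[ℂ] sl n,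
      IsEquivariantProduct (extRep n a) (extRep n b) (adRep n) φ ∧ φ ≠ 0 := by
  have h0 : (extLieHom n a).flip ≠ 0 := by
    intro h
    apply extLieHom_ne_zero ha (by omega : a < n)
    exact LinearMap.ext fun X => LinearMap.ext fun T => LinearMap.congr_fun₂ h T X
  -- The product is defined by `tr (φ(x, y) X) = vol (X·x ∧ y)`.
  obtain ⟨φ, hφ, h⟩ :=
    ((extLieHom_isEquivariantProduct (n := n) (a := a)).flip.actionForm (hab := hab)).exists_product
      tracePairing_injective rfl tracePairing_adRep
  refine ⟨φ, hφ, ?_⟩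
  rintro rfl
  apply actionForm_ne_zero hab h0
  rw [← h, (compr₂_eq_zero_iff tracePairing_injective).2 rfl]

theorem wedge_ne_zero (hab : a + b ≤ n) : wedge n a b ≠ 0 := by
  intro h
  have hinj : Function.Injective (Fin.castLE hab) := Fin.castLE_injective _
  have h1 := wedge_stdWedge (fun i => Fin.castLE hab (Fin.castAdd b i))
    (fun i => Fin.castLE hab (Fin.natAdd a i))
  rw [h, LinearMap.zero_apply, LinearMap.zero_apply] at h1
  refine stdWedge_ne_zero ?_ h1.symm
  convert hinj
  funext i
  refine Fin.addCases (fun i => ?_) (fun i => ?_) i <;> simp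

theorem exists_product_up (hl : l = m + m) (hln : l ≤ n) :
    ∃ φ : Ext n m →ₗ[ℂ] Ext n m →ₗ[ℂ] Ext n l,
      IsEquivariantProduct (extRep n m) (extRep n m) (extRep n l) φ ∧ φ ≠ 0 := by
  subst hl
  exact ⟨wedge n m m, wedge_extRep, wedge_ne_zero hln⟩

/-- The product is `⋆(⋆x ∧ ⋆y)`. Each star twists the action by inverse transpose, and the inner and
outer twists cancel; bijectivity of the star carries nonvanishing over from the wedge. -/
theorem exists_product_down (hl : l = m + m) (hn : l + m = n) :
    ∃ φ : Ext n l →ₗ[ℂ] Ext n l →ₗ[ℂ] Ext n m,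
      IsEquivariantProduct (extRep n l) (extRep n l) (extRep n m) φ ∧ φ ≠ 0 := by
  subst hl
  refine ⟨((wedge n m m).compl₁₂ (hodgeStar hn) (hodgeStar hn)).compr₂ (hodgeStar hn),
    fun g x y => ?_, fun h => ?_⟩
  · have : (((g⁻¹).transpose)⁻¹ : SL n).transpose = g := by
      have h1 : ((g⁻¹).transpose)⁻¹ = g.transpose := by
        apply inv_eq_of_mul_eq_one_right
        apply Subtype.ext
        rw [Matrix.SpecialLinearGroup.coe_mul, Matrix.SpecialLinearGroup.coe_transpose,
          Matrix.SpecialLinearGroup.coe_transpose, ← Matrix.transpose_mul, coe_mul_coe_inv]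
        simp
      rw [h1]
      apply Subtype.ext
      simp
    simp only [LinearMap.compr₂_apply, LinearMap.compl₁₂_apply, hodgeStar_extRep, wedge_extRep]
    rw [this]
  · apply wedge_ne_zero (n := n) (a := m) (b := m) (by omega)
    refine LinearMap.ext fun x => LinearMap.ext fun y => ?_
    obtain ⟨x, rfl⟩ := hodgeStar_surjective hn x
    obtain ⟨y, rfl⟩ := hodgeStar_surjective hn y
    apply hodgeStar_injective hn
    have := LinearMap.congr_fun₂ h x y
    simpa using this

end Existence

/-! ### Symmetry of the block `M × M → M*` -/

section Parity

variable {n k m r : ℕ} (φ : Fin m × Fin 3 ≃ Fin n) (ψ : Fin k ≃ Fin m × Fin r)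

/-- The index family that lists the blocks `α q` of `Fin m × Fin 3 ≃ Fin n`. -/
def blockIdx (α : Fin r → Fin 3) (j : Fin k) : Fin n :=
  φ ((ψ j).1, α (ψ j).2)

theorem blockIdx_injective {α : Fin r → Fin 3} (h : Function.Injective α) :
    Function.Injective (blockIdx φ ψ α) := by
  intro i j hij
  have := φ.injective hij
  rw [Prod.mk.injEq] at this
  exact ψ.injective (Prod.ext this.1 (h this.2))

theorem weight_blockIdx (α : Fin r → Fin 3) (i : Fin m) (p : Fin 3) :
    weight (blockIdx φ ψ α) (φ (i, p)) = ∑ q, if p = α q then 1 else 0 := by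
  unfold weight blockIdx
  simp only [Pi.single_apply, φ.injective.eq_iff, Prod.mk.injEq]
  rw [ψ.sum_comp fun w => if i = w.1 ∧ p = α w.2 then (1 : ℤ) else 0, Fintype.sum_prod_type]
  rw [Finset.sum_eq_single i (fun j _ hj => by simp [hj.symm]) (by simp)]
  simp

theorem prod_blockIdx (α : Fin r → Fin 3) (δ : Fin 3 → ℂ) :
    ∏ j, δ (φ.symm (blockIdx φ ψ α j)).2 = (∏ q, δ (α q)) ^ m := by
  unfold blockIdx
  simp only [Equiv.symm_apply_apply]
  rw [ψ.prod_comp fun w => δ (α w.2), Fintype.prod_prod_type]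
  simp

/-- The permutation of `Fin n` that exchanges the first two blocks. -/
def blockSwap : Equiv.Perm (Fin n) :=
  φ.permCongr (Equiv.prodCongrRight fun _ => Equiv.swap 0 1)

theorem blockSwap_comp (α : Fin r → Fin 3) :
    blockSwap φ ∘ blockIdx φ ψ α = blockIdx φ ψ (Equiv.swap 0 1 ∘ α) := by
  funext j
  simp [blockSwap, blockIdx, Equiv.permCongr_apply]

theorem sign_blockSwap : (Equiv.Perm.sign (blockSwap φ) : ℤ) = (-1) ^ m := by
  rw [blockSwap, Equiv.Perm.sign_permCongr, Equiv.Perm.sign_prodCongrRight]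
  simp

/-- Permuting the block labels permutes the factors by `m` parallel copies of `π`. -/
theorem stdWedge_blockIdx_comp (α : Fin r → Fin 3) (π : Equiv.Perm (Fin r)) :
    stdWedge (blockIdx φ ψ (α ∘ π)) =
      ((Equiv.Perm.sign π : ℤ) ^ m) • stdWedge (blockIdx φ ψ α) := by
  have h : blockIdx φ ψ (α ∘ π) = blockIdx φ ψ α ∘
      ψ.symm.permCongr (Equiv.prodCongrRight fun _ => π) := by
    funext j
    simp [blockIdx, Equiv.permCongr_apply]
  rw [h, stdWedge_comp_perm, Equiv.Perm.sign_permCongr, Equiv.Perm.sign_prodCongrRight]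
  simp

/-- Swapping blocks `0` and `1`, with sign `-1` on block `0`, has determinant `(-1)^m (-1)^m = 1`.
It exchanges the wedges of `a` and `b` and preserves that of `c` up to sign; `hsign` makes the total
factor `(-1)^m`. Hence `f.flip - (-1)^m f` vanishes at one weight-zero triple, which suffices. -/
theorem IsInvariantForm.flip_eq_of_blocks (φ : Fin m × Fin 3 ≃ Fin n)
    (ψ : Fin k ≃ Fin m × Fin r) (hn : 0 < n) (hr : r = 1 ∨ r = 2) (hk : 3 * k = r * n)
    {f : Ext n k →ₗ[ℂ] Ext n k →ₗ[ℂ] Ext n k →ₗ[ℂ] ℂ}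
    (hf : IsInvariantForm (extRep n k) (extRep n k) (extRep n k) f)
    {a b c : Fin r → Fin 3} (ha : Function.Injective a) (hb : Function.Injective b)
    (hc : Function.Injective c) (hab : Equiv.swap 0 1 ∘ a = b) (hba : Equiv.swap 0 1 ∘ b = a)
    {π : Equiv.Perm (Fin r)} (hcc : Equiv.swap 0 1 ∘ c = c ∘ π)
    (hw : ∀ p, ((∑ q, if p = a q then 1 else 0) + (∑ q, if p = b q then 1 else 0) +
      ∑ q, if p = c q then 1 else 0 : ℤ) = r)
    (hsign : ((∏ q, if a q = 0 then -1 else 1) * (∏ q, if b q = 0 then -1 else 1) *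
      (∏ q, if c q = 0 then -1 else 1) * (Equiv.Perm.sign π : ℤ) : ℤ) = -1) :
    f.flip = (-1 : ℂ) ^ m • f := by
  have hinv : IsInvariantForm (extRep n k) (extRep n k) (extRep n k) f.flip :=
    fun g x y z => hf g y x z
  have h0 := hinv.smul_sub_smul hf 1 ((-1) ^ m)
  rw [one_smul] at h0
  refine sub_eq_zero.1 (h0.eq_zero_of_apply_eq_zero hn hr (by omega) (blockIdx_injective φ ψ ha)
    (blockIdx_injective φ ψ hb) (blockIdx_injective φ ψ hc) (fun x => ?_) ?_)
  · obtain ⟨⟨i, p⟩, rfl⟩ := φ.surjective x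
    rw [weight_blockIdx, weight_blockIdx, weight_blockIdx, hw]
  · let δ : Fin 3 → ℂ := fun p => if p = 0 then -1 else 1
    have hε : (Equiv.Perm.sign (blockSwap φ) : ℂ) * ∏ x, δ (φ.symm x).2 = 1 := by
      rw [sign_blockSwap, φ.symm.prod_comp fun w => δ w.2, Fintype.prod_prod_type]
      have : ∏ p, δ p = -1 := by simp [δ]
      simp only [this, Finset.prod_const, Finset.card_univ, Fintype.card_fin]
      push_cast
      rw [← mul_pow]
      simp
    have h1 := hf (monomial (blockSwap φ) _ hε) (stdWedge (blockIdx φ ψ a))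
      (stdWedge (blockIdx φ ψ b)) (stdWedge (blockIdx φ ψ c))
    have hs : (∏ q, δ (a q)) * (∏ q, δ (b q)) * (∏ q, δ (c q)) * ((Equiv.Perm.sign π : ℤ) : ℂ) =
        -1 := by
      have := congrArg (Int.cast : ℤ → ℂ) hsign
      push_cast at this
      exact this
    simp only [extRep_monomial, blockSwap_comp, hab, hba, hcc, stdWedge_blockIdx_comp,
      prod_blockIdx, map_smul, LinearMap.smul_apply, smul_eq_mul, map_zsmul, zsmul_eq_mul] at h1
    rw [LinearMap.sub_apply, LinearMap.sub_apply, LinearMap.sub_apply, LinearMap.smul_apply,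
      LinearMap.smul_apply, LinearMap.smul_apply, LinearMap.flip_apply, ← h1, ← hs]
    have h2 : ((-1 : ℂ) ^ m) * (-1) ^ m = 1 := by rw [← mul_pow]; simp
    rw [hs, smul_eq_mul, sub_eq_zero]
    have h3 : ((∏ q, δ (a q)) ^ m) * ((∏ q, δ (b q)) ^ m) * ((∏ q, δ (c q)) ^ m) *
        ((Equiv.Perm.sign π : ℤ) : ℂ) ^ m = (-1) ^ m := by
      rw [← mul_pow, ← mul_pow, ← mul_pow, hs]
    push_cast
    set F := f (stdWedge (blockIdx φ ψ b)) (stdWedge (blockIdx φ ψ a)) (stdWedge (blockIdx φ ψ c))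
    linear_combination (-F) * h2 - (-1) ^ m * F * h3

/-- The symmetry of invariant trilinear forms on `Λᵏ ℂⁿ`, `n = 3m`, `k ∈ {m, 2m}`. -/
theorem IsInvariantForm.flip_eq (hn : 0 < n) (hm : n = 3 * m) (hr : r = 1 ∨ r = 2)
    (hk : k = m * r)
    {f : Ext n k →ₗ[ℂ] Ext n k →ₗ[ℂ] Ext n k →ₗ[ℂ] ℂ}
    (hf : IsInvariantForm (extRep n k) (extRep n k) (extRep n k) f) :
    f.flip = (-1 : ℂ) ^ m • f := by
  let φ : Fin m × Fin 3 ≃ Fin n := finProdFinEquiv.trans (finCongr (by omega))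
  let ψ : Fin k ≃ Fin m × Fin r := (finCongr hk).trans finProdFinEquiv.symm
  have hk' : 3 * k = r * n := by rw [hk, hm]; ring
  rcases hr with rfl | rfl
  -- For `k = m` each wedge is one block, and the third block is untouched by the swap.
  · exact hf.flip_eq_of_blocks φ ψ hn (Or.inl rfl) hk' (a := ![0]) (b := ![1]) (c := ![2])
      (Function.injective_of_subsingleton _) (Function.injective_of_subsingleton _)
      (Function.injective_of_subsingleton _) (by decide) (by decide) (π := 1) (by decide)
      (by decide) (by decide)
  -- For `k = 2m` the wedges are the three pairs of blocks, so every block occurs twice. The pair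
  -- `![0, 1]` is reversed by the swap, whence the nontrivial `π`.
  · exact hf.flip_eq_of_blocks φ ψ hn (Or.inr rfl) hk' (a := ![0, 2]) (b := ![1, 2]) (c := ![0, 1])
      (by decide) (by decide) (by decide) (by decide) (by decide) (π := Equiv.swap 0 1)
      (by decide) (by decide) (by decide)

theorem IsEquivariantProduct.flip_eq (hn : 0 < n) (hm : n = 3 * m) (hr : r = 1 ∨ r = 2)
    (hk : k = m * r) {l : ℕ} (hkl : l + k = n) {φ : Ext n k →ₗ[ℂ] Ext n k →ₗ[ℂ] Ext n l}
    (hφ : IsEquivariantProduct (extRep n k) (extRep n k) (extRep n l) φ) :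
    φ.flip = (-1 : ℂ) ^ m • φ :=
  eq_smul_of_compr₂_eq_smul (volPairing_injective hkl)
    ((hφ.isInvariantForm (volPairing_extRep hkl)).flip_eq hn hm hr hk)

end Parity

/-! ### Decomposing a graded bracket into blocks -/

section Blocks

variable {n k : ℕ}

theorem algRep_inZero (g : SL n) (X : sl n) :
    algRep n k g (inZero n k X) = inZero n k (adRep n g X) := by
  simp [algRep, inZero]

theorem algRep_inPlus (g : SL n) (T : Ext n k) :
    algRep n k g (inPlus n k T) = inPlus n k (extRep n k g T) := by
  simp [algRep, inPlus]

theorem algRep_inMinus (g : SL n) (T : Ext n (n - k)) :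
    algRep n k g (inMinus n k T) = inMinus n k (extRep n (n - k) g T) := by
  simp [algRep, inMinus]

/-- The projection of `𝔞` onto `𝔞₀`. -/
noncomputable def prZero (n k : ℕ) : Alg n k →ₗ[ℂ] sl n := LinearMap.fst ℂ _ _

/-- The projection of `𝔞` onto `𝔞₁`. -/
noncomputable def prPlus (n k : ℕ) : Alg n k →ₗ[ℂ] Ext n k :=
  LinearMap.fst ℂ _ _ ∘ₗ LinearMap.snd ℂ _ _

/-- The projection of `𝔞` onto `𝔞₋₁`. -/
noncomputable def prMinus (n k : ℕ) : Alg n k →ₗ[ℂ] Ext n (n - k) :=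
  LinearMap.snd ℂ _ _ ∘ₗ LinearMap.snd ℂ _ _

theorem prZero_algRep (g : SL n) (x : Alg n k) :
    prZero n k (algRep n k g x) = adRep n g (prZero n k x) := rfl

theorem prPlus_algRep (g : SL n) (x : Alg n k) :
    prPlus n k (algRep n k g x) = extRep n k g (prPlus n k x) := rfl

theorem prMinus_algRep (g : SL n) (x : Alg n k) :
    prMinus n k (algRep n k g x) = extRep n (n - k) g (prMinus n k x) := rfl

theorem inZero_prZero {x : Alg n k} (hx : x ∈ grade n k 0) : inZero n k (prZero n k x) = x := by
  obtain ⟨y, rfl⟩ := hx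
  rfl

theorem inPlus_prPlus {x : Alg n k} (hx : x ∈ grade n k 1) : inPlus n k (prPlus n k x) = x := by
  obtain ⟨y, rfl⟩ := hx
  rfl

theorem inMinus_prMinus {x : Alg n k} (hx : x ∈ grade n k 2) :
    inMinus n k (prMinus n k x) = x := by
  obtain ⟨y, rfl⟩ := hx
  rfl

variable {P Q R : Type*} [AddCommGroup P] [Module ℂ P] [AddCommGroup Q] [Module ℂ Q]
  [AddCommGroup R] [Module ℂ R]

/-- The block of a bracket determined by two inclusions and a projection. -/
noncomputable def block (B : Bracket n k) (ι : P →ₗ[ℂ] Alg n k) (κ : Q →ₗ[ℂ] Alg n k)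
    (p : Alg n k →ₗ[ℂ] R) : P →ₗ[ℂ] Q →ₗ[ℂ] R :=
  (B.compl₁₂ ι κ).compr₂ p

theorem block_apply (B : Bracket n k) (ι : P →ₗ[ℂ] Alg n k) (κ : Q →ₗ[ℂ] Alg n k)
    (p : Alg n k →ₗ[ℂ] R) (x : P) (y : Q) : block B ι κ p x y = p (B (ι x) (κ y)) := rfl

theorem IsEquivariant.block {B : Bracket n k} (hB : IsEquivariant B) {ι : P →ₗ[ℂ] Alg n k}
    {κ : Q →ₗ[ℂ] Alg n k} {p : Alg n k →ₗ[ℂ] R} {ρ₁ : Representation ℂ (SL n) P}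
    {ρ₂ : Representation ℂ (SL n) Q} {ρ₃ : Representation ℂ (SL n) R}
    (hι : ∀ g x, algRep n k g (ι x) = ι (ρ₁ g x)) (hκ : ∀ g x, algRep n k g (κ x) = κ (ρ₂ g x))
    (hp : ∀ g x, p (algRep n k g x) = ρ₃ g (p x)) :
    IsEquivariantProduct ρ₁ ρ₂ ρ₃ (block B ι κ p) := by
  intro g x y
  rw [block_apply, block_apply, ← hι, ← hκ, hB, hp]

/-- Two graded brackets are proportional on a block as soon as equivariant products between the
corresponding representations are unique up to a scalar. -/
theorem exists_smul_eq_of_block {i j : ZMod 3} {B B' : Bracket n k} {ι : P →ₗ[ℂ] Alg n k}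
    {κ : Q →ₗ[ℂ] Alg n k} {p : Alg n k →ₗ[ℂ] R} {q : R →ₗ[ℂ] Alg n k}
    (hB : IsGraded B) (hB' : IsGraded B') (h0 : IsNontrivial B) (h0' : IsNontrivial B')
    (hi : grade n k i = LinearMap.range ι) (hj : grade n k j = LinearMap.range κ)
    (hq : ∀ x ∈ grade n k (i + j), q (p x) = x)
    (h : block B ι κ p ≠ 0 → block B' ι κ p ≠ 0 →
      ∃ c : ℂ, c ≠ 0 ∧ block B' ι κ p = c • block B ι κ p) :
    ∃ c : ℂ, c ≠ 0 ∧ ∀ x ∈ grade n k i, ∀ y ∈ grade n k j, B' x y = c • B x y := by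
  have key : ∀ {B : Bracket n k}, IsGraded B → ∀ x y, q (block B ι κ p x y) = B (ι x) (κ y) :=
    fun hB x y => hq _ (hB i j _ (hi ▸ ⟨x, rfl⟩) _ (hj ▸ ⟨y, rfl⟩))
  have hne : ∀ {B : Bracket n k}, IsGraded B → IsNontrivial B → block B ι κ p ≠ 0 := by
    intro B hB h0 hz
    obtain ⟨x, hx, y, hy, hxy⟩ := h0 i j
    rw [hi] at hx
    rw [hj] at hy
    obtain ⟨x, rfl⟩ := hx
    obtain ⟨y, rfl⟩ := hy
    apply hxy
    rw [← key hB, hz]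
    simp
  obtain ⟨c, hc, h1⟩ := h (hne hB h0) (hne hB' h0')
  refine ⟨c, hc, fun x hx y hy => ?_⟩
  rw [hi] at hx
  rw [hj] at hy
  obtain ⟨x, rfl⟩ := hx
  obtain ⟨y, rfl⟩ := hy
  rw [← key hB, ← key hB', h1]
  simp

end Blocks

/-! ### Assembling a bracket from its blocks -/

section Construction

variable {n k : ℕ}

/-- The bracket on `𝔞` with prescribed blocks. -/
noncomputable def ofBlocks
    (b₁₁ : Ext n k →ₗ[ℂ] Ext n k →ₗ[ℂ] Ext n (n - k))
    (b₂₂ : Ext n (n - k) →ₗ[ℂ] Ext n (n - k) →ₗ[ℂ] Ext n k)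
    (b₁₂ : Ext n k →ₗ[ℂ] Ext n (n - k) →ₗ[ℂ] sl n) : Bracket n k :=
  -- No symmetry or Jacobi identity is imposed, so the blocks `M × 𝔤`, `M* × 𝔤` and `M* × M` simply
  -- reuse those with the factors exchanged, with a plus sign.
  LinearMap.mk₂ ℂ (fun x y =>
    (⁅x.1, y.1⁆ + b₁₂ x.2.1 y.2.2 + b₁₂ y.2.1 x.2.2,
      extLieHom n k x.1 y.2.1 + extLieHom n k y.1 x.2.1 + b₂₂ x.2.2 y.2.2,
      extLieHom n (n - k) x.1 y.2.2 + extLieHom n (n - k) y.1 x.2.2 + b₁₁ x.2.1 y.2.1))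
    (fun x x' y => by
      simp only [Prod.fst_add, Prod.snd_add, map_add, LinearMap.add_apply, add_lie, Prod.mk_add_mk,
        Prod.mk.injEq]
      refine ⟨?_, ?_, ?_⟩ <;> abel)
    (fun c x y => by
      simp only [Prod.smul_fst, Prod.smul_snd, map_smul, LinearMap.smul_apply, smul_lie,
        Prod.smul_mk, smul_add])
    (fun x x' y => by
      simp only [Prod.fst_add, Prod.snd_add, map_add, LinearMap.add_apply, lie_add, Prod.mk_add_mk,
        Prod.mk.injEq]
      refine ⟨?_, ?_, ?_⟩ <;> abel)
    (fun c x y => by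
      simp only [Prod.smul_fst, Prod.smul_snd, map_smul, LinearMap.smul_apply, lie_smul,
        Prod.smul_mk, smul_add])

variable {b₁₁ : Ext n k →ₗ[ℂ] Ext n k →ₗ[ℂ] Ext n (n - k)}
  {b₂₂ : Ext n (n - k) →ₗ[ℂ] Ext n (n - k) →ₗ[ℂ] Ext n k}
  {b₁₂ : Ext n k →ₗ[ℂ] Ext n (n - k) →ₗ[ℂ] sl n}

theorem ofBlocks_apply (x y : Alg n k) : ofBlocks b₁₁ b₂₂ b₁₂ x y =
    (⁅x.1, y.1⁆ + b₁₂ x.2.1 y.2.2 + b₁₂ y.2.1 x.2.2,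
      extLieHom n k x.1 y.2.1 + extLieHom n k y.1 x.2.1 + b₂₂ x.2.2 y.2.2,
      extLieHom n (n - k) x.1 y.2.2 + extLieHom n (n - k) y.1 x.2.2 + b₁₁ x.2.1 y.2.1) := rfl

theorem adRep_lie (g : SL n) (X Y : sl n) : ⁅adRep n g X, adRep n g Y⁆ = adRep n g ⁅X, Y⁆ := by
  apply Subtype.ext
  rw [LieAlgebra.SpecialLinear.sl_bracket, val_adRep_mul_val_adRep, val_adRep_mul_val_adRep, val_adRep,
    LieAlgebra.SpecialLinear.sl_bracket, mul_sub, sub_mul]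

theorem ofBlocks_isEquivariant
    (h₁₁ : IsEquivariantProduct (extRep n k) (extRep n k) (extRep n (n - k)) b₁₁)
    (h₂₂ : IsEquivariantProduct (extRep n (n - k)) (extRep n (n - k)) (extRep n k) b₂₂)
    (h₁₂ : IsEquivariantProduct (extRep n k) (extRep n (n - k)) (adRep n) b₁₂) :
    IsEquivariant (ofBlocks b₁₁ b₂₂ b₁₂) := by
  rintro g ⟨X, S, S'⟩ ⟨Y, T, T'⟩
  change ofBlocks b₁₁ b₂₂ b₁₂ (adRep n g X, extRep n k g S, extRep n (n - k) g S')
    (adRep n g Y, extRep n k g T, extRep n (n - k) g T') = _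
  rw [ofBlocks_apply]
  simp only [extLieHom_isEquivariantProduct g, h₁₁ g, h₂₂ g, h₁₂ g, adRep_lie, ← map_add]
  rfl

theorem exists_lie_ne_zero (hn : 1 < n) : ∃ X Y : sl n, ⁅X, Y⁆ ≠ 0 := by
  by_contra! h
  exact LieAlgebra.SpecialLinear.sl_non_abelian (Fin n) ℂ (by simpa using hn)
    ⟨h⟩

theorem exists_ne_zero_of_ne_zero {P Q R : Type*} [AddCommGroup P] [Module ℂ P] [AddCommGroup Q]
    [Module ℂ Q] [AddCommGroup R] [Module ℂ R] {b : P →ₗ[ℂ] Q →ₗ[ℂ] R} (h : b ≠ 0) :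
    ∃ x y, b x y ≠ 0 := by
  by_contra! h'
  exact h (LinearMap.ext fun x => LinearMap.ext fun y => h' x y)

theorem ofBlocks_isNontrivialGJD (hk : 0 < k) (hkn : k < n)
    (h₁₁ : IsEquivariantProduct (extRep n k) (extRep n k) (extRep n (n - k)) b₁₁)
    (h₂₂ : IsEquivariantProduct (extRep n (n - k)) (extRep n (n - k)) (extRep n k) b₂₂)
    (h₁₂ : IsEquivariantProduct (extRep n k) (extRep n (n - k)) (adRep n) b₁₂)
    (h₁₁0 : b₁₁ ≠ 0) (h₂₂0 : b₂₂ ≠ 0) (h₁₂0 : b₁₂ ≠ 0) :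
    IsNontrivialGJD (ofBlocks b₁₁ b₂₂ b₁₂) where
  graded := by
    intro i j x hx y hy
    fin_cases i <;> fin_cases j <;> obtain ⟨x, rfl⟩ := hx <;> obtain ⟨y, rfl⟩ := hy
    · exact ⟨⁅x, y⁆, by simp [ofBlocks_apply, inZero]; rfl⟩
    · exact ⟨extLieHom n k x y, by simp [ofBlocks_apply, inZero, inPlus]⟩
    · exact ⟨extLieHom n (n - k) x y, by simp [ofBlocks_apply, inZero, inMinus]⟩
    · exact ⟨extLieHom n k y x, by simp [ofBlocks_apply, inZero, inPlus]⟩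
    · exact ⟨b₁₁ x y, by simp [ofBlocks_apply, inMinus, inPlus]⟩
    · exact ⟨b₁₂ x y, by simp [ofBlocks_apply, inZero, inPlus, inMinus]; rfl⟩
    · exact ⟨extLieHom n (n - k) y x, by simp [ofBlocks_apply, inZero, inMinus]⟩
    · exact ⟨b₁₂ y x, by simp [ofBlocks_apply, inZero, inPlus, inMinus]; rfl⟩
    · exact ⟨b₂₂ x y, by simp [ofBlocks_apply, inMinus, inPlus]⟩
  equivariant := ofBlocks_isEquivariant h₁₁ h₂₂ h₁₂
  agrees :=
    { zero := fun X Y => by simp [ofBlocks_apply, inZero]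
      plus := fun X T => by simp [ofBlocks_apply, inZero, inPlus, extLieHom_apply]
      minus := fun X T => by simp [ofBlocks_apply, inZero, inMinus, extLieHom_apply] }
  nontrivial := by
    have hlie := exists_lie_ne_zero (by omega : 1 < n)
    have ha := exists_ne_zero_of_ne_zero (extLieHom_ne_zero hk hkn)
    have hb := exists_ne_zero_of_ne_zero (extLieHom_ne_zero (by omega : 0 < n - k)
      (by omega : n - k < n))
    have h11 := exists_ne_zero_of_ne_zero h₁₁0
    have h22 := exists_ne_zero_of_ne_zero h₂₂0
    have h12 := exists_ne_zero_of_ne_zero h₁₂0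
    intro i j
    fin_cases i <;> fin_cases j
    · obtain ⟨x, y, h⟩ := hlie
      exact ⟨_, ⟨x, rfl⟩, _, ⟨y, rfl⟩, by simpa [ofBlocks_apply, inZero] using h⟩
    · obtain ⟨x, y, h⟩ := ha
      exact ⟨_, ⟨x, rfl⟩, _, ⟨y, rfl⟩, by simpa [ofBlocks_apply, inZero, inPlus] using h⟩
    · obtain ⟨x, y, h⟩ := hb
      exact ⟨_, ⟨x, rfl⟩, _, ⟨y, rfl⟩, by simpa [ofBlocks_apply, inZero, inMinus] using h⟩
    · obtain ⟨x, y, h⟩ := ha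
      exact ⟨_, ⟨y, rfl⟩, _, ⟨x, rfl⟩, by simpa [ofBlocks_apply, inZero, inPlus] using h⟩
    · obtain ⟨x, y, h⟩ := h11
      exact ⟨_, ⟨x, rfl⟩, _, ⟨y, rfl⟩, by simpa [ofBlocks_apply, inPlus] using h⟩
    · obtain ⟨x, y, h⟩ := h12
      exact ⟨_, ⟨x, rfl⟩, _, ⟨y, rfl⟩, by simpa [ofBlocks_apply, inMinus, inPlus] using h⟩
    · obtain ⟨x, y, h⟩ := hb
      exact ⟨_, ⟨y, rfl⟩, _, ⟨x, rfl⟩, by simpa [ofBlocks_apply, inZero, inMinus] using h⟩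
    · obtain ⟨x, y, h⟩ := h12
      exact ⟨_, ⟨y, rfl⟩, _, ⟨x, rfl⟩, by simpa [ofBlocks_apply, inMinus, inPlus] using h⟩
    · obtain ⟨x, y, h⟩ := h22
      exact ⟨_, ⟨x, rfl⟩, _, ⟨y, rfl⟩, by simpa [ofBlocks_apply, inMinus] using h⟩

theorem exists_isNontrivialGJD (hn : 0 < n) (hk : k ≤ n) (h : n = 3 * k ∨ n = 3 * (n - k)) :
    ∃ B : Bracket n k, IsNontrivialGJD B := by
  have hk0 : 0 < k := by omega
  have hkn : k < n := by omega
  obtain ⟨b₁₂, h₁₂, h₁₂0⟩ := exists_product_sl hk0 (by omega : 0 < n - k) (Nat.add_sub_of_le hk)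
  rcases h with h | h
  · obtain ⟨b₁₁, h₁₁, h₁₁0⟩ := exists_product_up (n := n) (m := k) (l := n - k) (by omega) (by omega)
    obtain ⟨b₂₂, h₂₂, h₂₂0⟩ :=
      exists_product_down (n := n) (m := k) (l := n - k) (by omega) (by omega)
    exact ⟨_, ofBlocks_isNontrivialGJD hk0 hkn h₁₁ h₂₂ h₁₂ h₁₁0 h₂₂0 h₁₂0⟩
  · obtain ⟨b₂₂, h₂₂, h₂₂0⟩ := exists_product_up (n := n) (m := n - k) (l := k) (by omega) (by omega)
    obtain ⟨b₁₁, h₁₁, h₁₁0⟩ :=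
      exists_product_down (n := n) (m := n - k) (l := k) (by omega) (by omega)
    exact ⟨_, ofBlocks_isNontrivialGJD hk0 hkn h₁₁ h₂₂ h₁₂ h₁₁0 h₂₂0 h₁₂0⟩

end Construction

/-! ### Admissible degrees, uniqueness and parity for brackets -/

section Main

variable {n k : ℕ}

theorem IsGraded.inMinus_block {B : Bracket n k} (hB : IsGraded B) (S T : Ext n k) :
    inMinus n k (block B (inPlus n k) (inPlus n k) (prMinus n k) S T) =
      B (inPlus n k S) (inPlus n k T) :=
  inMinus_prMinus (hB 1 1 _ ⟨S, rfl⟩ _ ⟨T, rfl⟩)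

theorem IsGraded.inPlus_block {B : Bracket n k} (hB : IsGraded B) (S T : Ext n (n - k)) :
    inPlus n k (block B (inMinus n k) (inMinus n k) (prPlus n k) S T) =
      B (inMinus n k S) (inMinus n k T) :=
  inPlus_prPlus (hB 2 2 _ ⟨S, rfl⟩ _ ⟨T, rfl⟩)

/-- By duality the two blocks are forms on three copies of `Λˡ` with `l = k` or `l = n - k`. A
nonzero one needs `n ∣ 3l`, and `0 < l < n` leaves only the quotients `1` and `2`. -/
theorem IsGraded.blocks_eq_zero (hk0 : 0 < k) (hkn : k < n)
    (h : ¬ (n = 3 * k ∨ n = 3 * (n - k))) {B : Bracket n k} (hB : IsGraded B)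
    (hE : IsEquivariant B) :
    (∀ S T : Ext n k, B (inPlus n k S) (inPlus n k T) = 0) ∧
      (∀ S T : Ext n (n - k), B (inMinus n k S) (inMinus n k T) = 0) := by
  have hn : 0 < n := by omega
  have hdvd : ∀ l, 0 < l → l < n → n ≠ 3 * l → n ≠ 3 * (n - l) → ¬ n ∣ l + l + l := by
    rintro l h0 hl h1 h2 ⟨q, hq⟩
    have : q < 3 := by
      by_contra! hq3
      have := Nat.mul_le_mul_left n hq3
      omega
    interval_cases q <;> omega
  constructor
  · intro S T
    rw [← hB.inMinus_block, (hE.block algRep_inPlus algRep_inPlus prMinus_algRep).eq_zero_ext hn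
      (Nat.sub_add_cancel hkn.le) (hdvd k hk0 hkn (by omega) (by omega))]
    simp
  · intro S T
    rw [← hB.inPlus_block, (hE.block algRep_inMinus algRep_inMinus prPlus_algRep).eq_zero_ext hn
      (Nat.add_sub_of_le hkn.le) (hdvd (n - k) (by omega) (by omega) (by omega) (by omega))]
    simp

/-- The extreme values of `k` are excluded because `𝔰𝔩ₙ` acts by zero on `Λ⁰`, killing the block `𝔤
× M` or `𝔤 × M*`; otherwise the block `M × M` decides. -/
theorem IsNontrivialGJD.degree (hk : k ≤ n) {B : Bracket n k}
    (hB : IsNontrivialGJD B) : n = 3 * k ∨ n = 3 * (n - k) := by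
  have hk0 : 0 < k := by
    rw [Nat.pos_iff_ne_zero]
    rintro rfl
    obtain ⟨_, ⟨x, rfl⟩, _, ⟨y, rfl⟩, h⟩ := hB.nontrivial 0 1
    apply h
    rw [hB.agrees.plus, extLie_degree_zero, map_zero]
  have hkn : k < n := by
    refine lt_of_le_of_ne hk ?_
    rintro rfl
    obtain ⟨_, ⟨x, rfl⟩, _, ⟨y, rfl⟩, h⟩ := hB.nontrivial 0 2
    apply h
    have h0 : ∀ (l : ℕ) (_ : l = 0) (T : Ext k l), extLie k l x T = 0 := by
      rintro l rfl T
      exact extLie_degree_zero x T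
    rw [hB.agrees.minus, h0 _ (Nat.sub_self k), map_zero]
  by_contra hne
  obtain ⟨_, ⟨x, rfl⟩, _, ⟨y, rfl⟩, h⟩ := hB.nontrivial 1 1
  exact h ((hB.graded.blocks_eq_zero hk0 hkn hne hB.equivariant).1 x y)

/-- Agreement with the action fixes the three blocks with left factor `𝔤`, with scalar `1`; the
other six come from uniqueness of equivariant products. -/
theorem IsNontrivialGJD.essentiallyEqual (hn : 0 < n) (hk : k ≤ n) {B B' : Bracket n k}
    (hB : IsNontrivialGJD B) (hB' : IsNontrivialGJD B') : EssentiallyEqual B B' := by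
  have hdeg := hB.degree hk
  have hadd := Nat.add_sub_of_le hk
  have hadd' := Nat.sub_add_cancel hk
  -- The multiplicities for `M` and `M*` are `1` and `2` in one order or the other, according to
  -- which of the two is the smaller power.
  obtain ⟨r, hr, hkr⟩ : ∃ r, (r = 1 ∨ r = 2) ∧ k + k + k = r * n := by
    rcases hdeg with h | h
    · exact ⟨1, Or.inl rfl, by omega⟩
    · exact ⟨2, Or.inr rfl, by omega⟩
  obtain ⟨r', hr', hkr'⟩ : ∃ r, (r = 1 ∨ r = 2) ∧ (n - k) + (n - k) + (n - k) = r * n := by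
    rcases hdeg with h | h
    · exact ⟨2, Or.inr rfl, by omega⟩
    · exact ⟨1, Or.inl rfl, by omega⟩
  have hE := hB.equivariant
  have hE' := hB'.equivariant
  have key : ∀ i j : ZMod 3, ∃ c : ℂ, c ≠ 0 ∧
      ∀ x ∈ grade n k i, ∀ y ∈ grade n k j, B' x y = c • B x y := by
    intro i j
    fin_cases i <;> fin_cases j
    · refine ⟨1, one_ne_zero, ?_⟩
      rintro _ ⟨x, rfl⟩ _ ⟨y, rfl⟩
      rw [hB.agrees.zero, hB'.agrees.zero, one_smul]
    · refine ⟨1, one_ne_zero, ?_⟩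
      rintro _ ⟨x, rfl⟩ _ ⟨y, rfl⟩
      rw [hB.agrees.plus, hB'.agrees.plus, one_smul]
    · refine ⟨1, one_ne_zero, ?_⟩
      rintro _ ⟨x, rfl⟩ _ ⟨y, rfl⟩
      rw [hB.agrees.minus, hB'.agrees.minus, one_smul]
    · exact exists_smul_eq_of_block (i := 1) (j := 0) hB.graded hB'.graded hB.nontrivial
        hB'.nontrivial rfl rfl (fun x hx => inPlus_prPlus hx)
        ((hE.block algRep_inPlus algRep_inZero prPlus_algRep).exists_smul_eq_action hn hk
          (hE'.block algRep_inPlus algRep_inZero prPlus_algRep))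
    · exact exists_smul_eq_of_block (i := 1) (j := 1) hB.graded hB'.graded hB.nontrivial
        hB'.nontrivial rfl rfl (fun x hx => inMinus_prMinus hx)
        ((hE.block algRep_inPlus algRep_inPlus prMinus_algRep).exists_smul_eq_ext hn hr hadd' hkr
          (hE'.block algRep_inPlus algRep_inPlus prMinus_algRep))
    · exact exists_smul_eq_of_block (i := 1) (j := 2) hB.graded hB'.graded hB.nontrivial
        hB'.nontrivial rfl rfl (fun x hx => inZero_prZero hx)
        ((hE.block algRep_inPlus algRep_inMinus prZero_algRep).exists_smul_eq_sl hn hadd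
          (hE'.block algRep_inPlus algRep_inMinus prZero_algRep))
    · exact exists_smul_eq_of_block (i := 2) (j := 0) hB.graded hB'.graded hB.nontrivial
        hB'.nontrivial rfl rfl (fun x hx => inMinus_prMinus hx)
        ((hE.block algRep_inMinus algRep_inZero prMinus_algRep).exists_smul_eq_action hn
          (Nat.sub_le n k) (hE'.block algRep_inMinus algRep_inZero prMinus_algRep))
    · exact exists_smul_eq_of_block (i := 2) (j := 1) hB.graded hB'.graded hB.nontrivial
        hB'.nontrivial rfl rfl (fun x hx => inZero_prZero hx)
        ((hE.block algRep_inMinus algRep_inPlus prZero_algRep).exists_smul_eq_sl hn hadd'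
          (hE'.block algRep_inMinus algRep_inPlus prZero_algRep))
    · exact exists_smul_eq_of_block (i := 2) (j := 2) hB.graded hB'.graded hB.nontrivial
        hB'.nontrivial rfl rfl (fun x hx => inPlus_prPlus hx)
        ((hE.block algRep_inMinus algRep_inMinus prPlus_algRep).exists_smul_eq_ext hn hr' hadd hkr'
          (hE'.block algRep_inMinus algRep_inMinus prPlus_algRep))
  choose c hc using key
  exact ⟨c, hc⟩

theorem IsGraded.parity (hn : 0 < n) (hk : k ≤ n) {B : Bracket n k} (hB : IsGraded B)
    (hE : IsEquivariant B) {m : ℕ} (hm : n = 3 * m) (hmk : m = k ∨ m = n - k) (S T : Ext n k) :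
    B (inPlus n k S) (inPlus n k T) = (-1 : ℂ) ^ m • B (inPlus n k T) (inPlus n k S) := by
  obtain ⟨r, hr, hkr⟩ : ∃ r, (r = 1 ∨ r = 2) ∧ k = m * r := by
    rcases hmk with h | h
    · exact ⟨1, Or.inl rfl, by omega⟩
    · exact ⟨2, Or.inr rfl, by omega⟩
  have h := (hE.block algRep_inPlus algRep_inPlus prMinus_algRep).flip_eq hn hm hr hkr
    (Nat.sub_add_cancel hk)
  have h1 := LinearMap.congr_fun₂ h T S
  rw [LinearMap.flip_apply] at h1
  rw [← hB.inMinus_block, h1, ← hB.inMinus_block]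
  simp

end Main

end TensorAlgebraZ3


open TensorAlgebraZ3
theorem mainTheorem2 (n k : ℕ) (hn : 0 < n) (hk : k ≤ n) :
    -- existence precisely when `n = 3k`, up to exchanging `M` and `M*`
    ((∃ B : Bracket n k, IsNontrivialGJD B) ↔ (n = 3 * k ∨ n = 3 * (n - k))) ∧
    -- otherwise the blocks `M × M → M*` and `M* × M* → M` always vanish
    (0 < k → k < n → ¬ (n = 3 * k ∨ n = 3 * (n - k)) →
      ∀ B : Bracket n k, IsGraded B → IsEquivariant B →
        (∀ S T : Ext n k, B (inPlus n k S) (inPlus n k T) = 0) ∧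
        (∀ S T : Ext n (n - k), B (inMinus n k S) (inMinus n k T) = 0)) ∧
    -- essential uniqueness
    (∀ B B' : Bracket n k, IsNontrivialGJD B → IsNontrivialGJD B' → EssentiallyEqual B B') ∧
    -- the parity of the block `M × M → M*`
    (∀ B : Bracket n k, IsGraded B → IsEquivariant B →
      ∀ m : ℕ, n = 3 * m → (m = k ∨ m = n - k) →
        (Odd m → ∀ S T : Ext n k,
          B (inPlus n k S) (inPlus n k T) = - B (inPlus n k T) (inPlus n k S)) ∧
        (Even m → ∀ S T : Ext n k,
          B (inPlus n k S) (inPlus n k T) = B (inPlus n k T) (inPlus n k S))) := by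
  refine ⟨⟨fun ⟨B, hB⟩ => hB.degree hk, exists_isNontrivialGJD hn hk⟩,
    fun hk0 hkn h B hB hE => hB.blocks_eq_zero hk0 hkn h hE,
    fun B B' hB hB' => hB.essentiallyEqual hn hk hB', fun B hB hE m hm hmk => ⟨?_, ?_⟩⟩
  · intro hodd S T
    rw [hB.parity hn hk hE hm hmk, hodd.neg_one_pow]
    exact neg_one_smul ℂ (B (inPlus n k T) (inPlus n k S))
  · intro heven S T
    rw [hB.parity hn hk hE hm hmk, heven.neg_one_pow, one_smul]
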